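/- Conventions. Let $F$ be the free semigroup on a countably infinite alphabet; its elements are called semigroup words. An epigroup is a semigroup in which some power $x^n$ ($n\ge 1$) of each element $x$ lies in a subgroup; it is regarded as a unary semigroup with the operation of pseudoinversion $x\mapsto\overline{x}$, where $\overline{x}$ is the inverse of $xe_x$ in the maximal subgroup with unit $e_x$ containing a power of $x$. A variety of semigroups is the class of all semigroups satisfying a given set of identities between semigroup words; a variety of epigroups is the class of all unary semigroups satisfying a given set of identities between words of the free unary semigroup of countably infinite rank, all of whose members are epigroups with the operation of pseudoinversion. $\mathbb{SEM}$ and $\mathbb{EPI}$ are the lattices of all semigroup varieties and of all epigroup varieties, ordered by inclusion. A nil-variety is a variety consisting of nilsemigroups, i.e. semigroups with $0$ in which every element has a power equal to $0$. An element $x$ of a lattice $L$ is modular if $(x\vee y)\wedge z=(x\wedge z)\vee y$ for all $y\le z$ in $L$. An identity $u\approx 0$ holds in $V$ if in every member of $V$ all values of $u$ are equal to the zero element. Write $\mathrm{alph}(u)$ for the set of letters of $u$. An identity $u\approx v$ is substitutive if $\mathrm{alph}(u)=\mathrm{alph}(v)$ and $v$ is obtained from $u$ by renaming letters. Put $I(V)=\{u\in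 F : u\approx 0 \text{ holds in } V\}$, and let $\sim_V$ be the fully invariant congruence $\{(u,v)\in F\times F : u\approx v\text{ holds in }V\}$ on $F$. For $u,v\in F$ write $u\le v$ if $v=a\,\xi(u)\,b$ for some endomorphism $\xi$ of $F$ and some, possibly empty, words $a,b$; write $u\sim v$ if $u\le v$ and $v\le u$; and $u<v$ if $u\le v$ and $u\not\sim v$. A set $M\subseteq F$ is a check set if (1) $\mathrm{alph}(u)=\mathrm{alph}(v)$ for all $u,v\in M$; (2) $u\not<v$ for all $u,v\in M$; (3) if $u\in M$, $u\sim v$ and $\mathrm{alph}(u)=\mathrm{alph}(v)$, then $v\in M$. If $A$ is the common set of letters of the words of $M$, the symmetric group $S(A)$ acts on $M$ by renaming letters, and $\mathrm{Con}(M)$ is the lattice of congruences of this $S(A)$-set, i.e. of the equivalence relations on $M$ invariant under $S(A)$. Proposition 3.1. Suppose that a nil-variety $V$ of semigroups is a modular element of $\mathbb{SEM}$, or that a nil-variety $V$ of epigroups is a modular element of $\mathbb{EPI}$. Then: (i) if an identity $u\approx v$ holds in $V$ (where $u,v$ are semigroup words in the case of $\mathbb{SEM}$, and arbitrary words of the free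 unary semigroup in the case of $\mathbb{EPI}$) and $u\approx 0$ does not hold in $V$, then the identity $u\approx v$ is substitutive; (ii) for every check set $M$ with $M\cap I(V)=\varnothing$, the restriction $\sim_V|_M$ is a modular element of the lattice $\mathrm{Con}(M)$. -/

import Mathlib

universe u

namespace SemigroupVarieties

/-! ## Modular elements and congruence lattices of `G`-sets -/

/-- An element `x` of a lattice is modular if `(x ⊔ y) ⊓ z = (x ⊓ z) ⊔ y` whenever `y ≤ z`. -/
def IsModularElement {L : Type*} [Lattice L] (x : L) : Prop :=
  ∀ y z : L, y ≤ z → (x ⊔ y) ⊓ z = (x ⊓ z) ⊔ y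

section GSet

variable {G : Type*} {X : Type*} [SMul G X]

theorem toSetoid_injective :
    Function.Injective (fun c : SMulCon G X => c.toSetoid) := by
  rintro ⟨r, hr⟩ ⟨s, hs⟩ h
  cases h
  rfl

/-- The congruences of a `G`-set, ordered by inclusion of relations. -/
instance : LE (SMulCon G X) := ⟨fun c d => c.toSetoid ≤ d.toSetoid⟩

instance : LT (SMulCon G X) := ⟨fun c d => c.toSetoid < d.toSetoid⟩

/-- The meet of two congruences of a `G`-set is their intersection. -/
instance : Min (SMulCon G X) :=
  ⟨fun c d => { c.toSetoid ⊓ d.toSetoid with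
    smul := fun g _ _ h => ⟨c.smul g h.1, d.smul g h.2⟩ }⟩

/-- The join of two congruences of a `G`-set is the equivalence relation they generate. -/
instance : Max (SMulCon G X) :=
  ⟨fun c d => { c.toSetoid ⊔ d.toSetoid with
    smul := by
      intro g x y h
      have key : c.toSetoid ⊔ d.toSetoid ≤ (c.toSetoid ⊔ d.toSetoid).comap (fun x => g • x) := by
        refine sup_le ?_ ?_
        · intro a b hab
          exact (le_sup_left : c.toSetoid ≤ c.toSetoid ⊔ d.toSetoid) (c.smul g hab)
        · intro a b hab
          exact (le_sup_right : d.toSetoid ≤ c.toSetoid ⊔ d.toSetoid) (d.smul g hab)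
      exact key h }⟩

/-- The congruence lattice `Con(X)` of a `G`-set `X`. -/
instance : Lattice (SMulCon G X) :=
  Function.Injective.lattice (fun c : SMulCon G X => c.toSetoid) toSetoid_injective
    Iff.rfl Iff.rfl (fun _ _ => rfl) (fun _ _ => rfl)

end GSet

/-! ## Semigroups -/

/-- `spow x n` is the power `x ^ (n + 1)`; a semigroup has positive powers only. -/
def spow {S : Type u} [Mul S] (x : S) : ℕ → S
  | 0 => x
  | n + 1 => spow x n * x

/-- `z` is a zero element of `S`. -/
def IsZeroElement {S : Type u} [Mul S] (z : S) : Prop :=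
  ∀ s : S, z * s = z ∧ s * z = z

/-- `S` is a nilsemigroup: it has a zero, and some power of every element is the zero. -/
def IsNilSemigroup (S : Type u) [Mul S] : Prop :=
  ∃ z : S, IsZeroElement z ∧ ∀ s : S, ∃ n : ℕ, spow s n = z

/-! ## Semigroup words -/

/-- The free semigroup `F` of countably infinite rank; its elements are the semigroup words. -/
abbrev Word : Type := FreeSemigroup ℕ

/-- The set of letters occurring in a semigroup word. -/
def Word.alph (w : Word) : Finset ℕ := (w.head :: w.tail).toFinset

/-- Letterwise renaming of a semigroup word. -/
abbrev Word.rename (f : ℕ → ℕ) (w : Word) : Word := FreeSemigroup.map f w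

/-- The preorder `u ≤ v` on words: `v = a ξ(u) b` for an endomorphism `ξ` of `F` and some `a`, `b`
in the free monoid `F¹`. -/
def Word.Below (u v : Word) : Prop :=
  ∃ (ξ : Word →ₙ* Word) (a b : WithOne Word), (v : WithOne Word) = a * (ξ u : Word) * b

/-- `u ∼ v`: both `u ≤ v` and `v ≤ u`. -/
def Word.Equivalent (u v : Word) : Prop := u.Below v ∧ v.Below u

/-- `u < v`: `u ≤ v` and not `u ∼ v`. -/
def Word.StrictlyBelow (u v : Word) : Prop := u.Below v ∧ ¬ u.Equivalent v

/-- The identity `u ≈ v` is substitutive: the two words have the same letters, and `v` is obtained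
from `u` by renaming letters. -/
def IsSubstitutive (u v : Word) : Prop :=
  u.alph = v.alph ∧ ∃ σ : Equiv.Perm ℕ, v = u.rename σ

/-! ## Check sets and their congruence lattices -/

/-- A check set: all its words have the same set of letters, no word of it is strictly below another
one, and it is closed under equivalence of words with the same letters. The common set of letters is
recorded as `letters`; it is determined by the set of words as soon as that set is nonempty. -/
structure CheckSet where
  words : Set Word
  letters : Finset ℕ
  alph_eq : ∀ u ∈ words, u.alph = letters
  not_strictlyBelow : ∀ u ∈ words, ∀ v ∈ words, ¬ u.StrictlyBelow v
  closed : ∀ u ∈ words, ∀ v : Word, u.Equivalent v → u.alph = v.alph → v ∈ words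

/-- The letterwise action of a permutation of the finite set `A` of letters on words; letters
outside `A` stay fixed. -/
def permRename {A : Finset ℕ} (σ : Equiv.Perm A) (u : Word) : Word :=
  u.rename (Equiv.Perm.ofSubtype σ)

theorem rename_rename (f g : ℕ → ℕ) (u : Word) : (u.rename g).rename f = u.rename (f ∘ g) := by
  have h : (FreeSemigroup.map f).comp (FreeSemigroup.map g) = FreeSemigroup.map (f ∘ g) :=
    FreeSemigroup.hom_ext rfl
  exact DFunLike.congr_fun h u

theorem rename_id (u : Word) : u.rename id = u := by
  have h : (FreeSemigroup.map (id : ℕ → ℕ)) = MulHom.id Word :=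
    FreeSemigroup.hom_ext rfl
  exact DFunLike.congr_fun h u

theorem alph_of_mul (n : ℕ) (w : Word) :
    Word.alph (FreeSemigroup.of n * w) = insert n w.alph := by
  simp [Word.alph]

theorem alph_rename (f : ℕ → ℕ) (u : Word) : (u.rename f).alph = u.alph.image f := by
  induction u using FreeSemigroup.recOnMul with
  | ih1 n => simp [Word.alph, Word.rename]
  | ih2 n w _ h2 =>
    rw [alph_of_mul, Finset.image_insert, ← h2, Word.rename, map_mul, FreeSemigroup.map_of,
      alph_of_mul]

theorem below_rename (f : ℕ → ℕ) (u : Word) : u.Below (u.rename f) :=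
  ⟨FreeSemigroup.map f, 1, 1, by simp⟩

theorem permRename_mul {A : Finset ℕ} (σ τ : Equiv.Perm A) (u : Word) :
    permRename (σ * τ) u = permRename σ (permRename τ u) := by
  simp only [permRename, rename_rename, map_mul]
  rfl

theorem permRename_one {A : Finset ℕ} (u : Word) :
    permRename (1 : Equiv.Perm A) u = u := by
  simp only [permRename, map_one]
  exact rename_id u

theorem alph_permRename {A : Finset ℕ} (σ : Equiv.Perm A) (u : Word) (h : u.alph = A) :
    (permRename σ u).alph = A := by
  rw [permRename, alph_rename, h]
  refine Finset.eq_of_subset_of_card_le ?_ ?_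
  · intro x hx
    obtain ⟨y, hy, rfl⟩ := Finset.mem_image.1 hx
    rw [Equiv.Perm.ofSubtype_apply_of_mem σ hy]
    exact (σ ⟨y, hy⟩).2
  · rw [Finset.card_image_of_injective _ (Equiv.injective _)]

theorem permRename_mem (M : CheckSet) (σ : Equiv.Perm M.letters) {u : Word} (hu : u ∈ M.words) :
    permRename σ u ∈ M.words := by
  refine M.closed u hu _ ⟨below_rename _ u, ?_⟩ ?_
  · have h := below_rename (Equiv.Perm.ofSubtype σ⁻¹) (permRename σ u)
    change Word.Below _ (permRename σ⁻¹ (permRename σ u)) at h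
    rwa [← permRename_mul, inv_mul_cancel, permRename_one] at h
  · rw [M.alph_eq u hu, alph_permRename σ u (M.alph_eq u hu)]

/-- A check set `M` with set of letters `A` is an `S(A)`-set under letterwise renaming. -/
instance (M : CheckSet) : MulAction (Equiv.Perm M.letters) M.words where
  smul σ u := ⟨permRename σ u.1, permRename_mem M σ u.2⟩
  one_smul u := Subtype.ext (permRename_one u.1)
  mul_smul σ τ u := Subtype.ext (permRename_mul σ τ u.1)

/-- The congruence lattice `Con(M)` of the `S(A)`-set `M`. -/
abbrev CheckSet.ConLattice (M : CheckSet) : Type := SMulCon (Equiv.Perm M.letters) M.words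

/-- A fully invariant congruence on the free semigroup `F`. -/
structure FullyInvariantCon extends Con Word where
  map_endo : ∀ (ξ : Word →ₙ* Word) (u v : Word), toCon u v → toCon (ξ u) (ξ v)

/-- The restriction of a fully invariant congruence on `F` to a check set, as a congruence of the
`S(A)`-set. -/
def FullyInvariantCon.restrict (c : FullyInvariantCon) (M : CheckSet) : M.ConLattice where
  toSetoid := c.toCon.toSetoid.comap Subtype.val
  smul σ x y h := c.map_endo (FreeSemigroup.map (Equiv.Perm.ofSubtype σ)) x.1 y.1 h

/-! ## Varieties of semigroups -/

/-- The semigroup `S` satisfies the identity `u ≈ v`. -/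
def Satisfies (S : Type u) [Semigroup S] (u v : Word) : Prop :=
  ∀ φ : ℕ → S, FreeSemigroup.lift φ u = FreeSemigroup.lift φ v

/-- A variety of semigroups: the class of all semigroups satisfying some set of identities. -/
structure SemigroupVariety : Type (u + 1) where
  Mem : ∀ (S : Type u) [Semigroup S], Prop
  exists_identities : ∃ E : Set (Word × Word), ∀ (S : Type u) [Semigroup S],
    Mem S ↔ ∀ p ∈ E, Satisfies S p.1 p.2

namespace SemigroupVariety

/-- The identity `u ≈ v` holds in `V`. -/
def Holds (V : SemigroupVariety.{u}) (u v : Word) : Prop :=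
  ∀ (S : Type u) [Semigroup S], V.Mem S → Satisfies S u v

/-- The identity `u ≈ 0` holds in `V`: in every semigroup of `V` all values of `u` are equal to the
zero element. -/
def HoldsZero (V : SemigroupVariety.{u}) (u : Word) : Prop :=
  ∀ (S : Type u) [Semigroup S], V.Mem S → ∀ φ : ℕ → S, IsZeroElement (FreeSemigroup.lift φ u)

/-- `V` is a nil-variety. (Lean's semigroups may be empty; the empty one is disregarded.) -/
def IsNil (V : SemigroupVariety.{u}) : Prop :=
  ∀ (S : Type u) [Semigroup S], V.Mem S → Nonempty S → IsNilSemigroup S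

/-- The set `I(V)` of all words `u` such that `u ≈ 0` holds in `V`. -/
def zeroWords (V : SemigroupVariety.{u}) : Set Word := {u | V.HoldsZero u}

theorem lift_endo {S : Type u} [Semigroup S] (φ : ℕ → S) (ξ : Word →ₙ* Word) (u : Word) :
    FreeSemigroup.lift φ (ξ u) =
      FreeSemigroup.lift (fun n => FreeSemigroup.lift φ (ξ (FreeSemigroup.of n))) u := by
  have h : (FreeSemigroup.lift φ).comp ξ =
      FreeSemigroup.lift (fun n => FreeSemigroup.lift φ (ξ (FreeSemigroup.of n))) :=
    FreeSemigroup.hom_ext (by funext n; simp)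
  exact DFunLike.congr_fun h u

/-- The fully invariant congruence on `F` corresponding to `V`: two words are related when the
identity between them holds in `V`. -/
def sim (V : SemigroupVariety.{u}) : FullyInvariantCon where
  r := V.Holds
  iseqv := ⟨fun _ _ _ _ _ => rfl, fun h S _ hS φ => (h S hS φ).symm,
    fun h k S _ hS φ => (h S hS φ).trans (k S hS φ)⟩
  mul' := fun h k S _ hS φ => by rw [map_mul, map_mul, h S hS φ, k S hS φ]
  map_endo := fun ξ u v h S _ hS φ => by
    rw [lift_endo, lift_endo]
    exact h S hS _

theorem ext_mem {V W : SemigroupVariety.{u}}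
    (h : ∀ (S : Type u) [Semigroup S], V.Mem S ↔ W.Mem S) : V = W := by
  obtain ⟨V, hV⟩ := V
  obtain ⟨W, hW⟩ := W
  have : @V = @W := by
    funext S inst
    exact propext (h S)
  subst this
  rfl

/-- The lattice of all semigroup varieties, ordered by inclusion of classes. The meet is the
intersection of classes, and the join is the class defined by all identities that hold in both. -/
instance : Lattice SemigroupVariety.{u} where
  le V W := ∀ (S : Type u) [Semigroup S], V.Mem S → W.Mem S
  le_refl _ _ _ h := h
  le_trans _ _ _ h k S _ hS := k S (h S hS)
  le_antisymm _ _ h k := ext_mem fun S _ => ⟨h S, k S⟩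
  inf V W :=
    { Mem := fun S _ => V.Mem S ∧ W.Mem S
      exists_identities := by
        obtain ⟨E, hE⟩ := V.exists_identities
        obtain ⟨E', hE'⟩ := W.exists_identities
        refine ⟨E ∪ E', fun S _ => ?_⟩
        rw [hE, hE']
        simp only [Set.mem_union, or_imp, forall_and] }
  inf_le_left _ _ _ _ h := h.1
  inf_le_right _ _ _ _ h := h.2
  le_inf _ _ _ h k S _ hS := ⟨h S hS, k S hS⟩
  sup V W :=
    { Mem := fun S _ => ∀ u v : Word, V.Holds u v → W.Holds u v → Satisfies S u v
      exists_identities := ⟨{p | V.Holds p.1 p.2 ∧ W.Holds p.1 p.2}, fun S _ =>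
        ⟨fun h p hp => h p.1 p.2 hp.1 hp.2, fun h u v hu hv => h (u, v) ⟨hu, hv⟩⟩⟩ }
  le_sup_left _ _ S _ hS _ _ h _ := h S hS
  le_sup_right _ _ S _ hS _ _ _ h := h S hS
  sup_le V W X h k S _ hS := by
    obtain ⟨E, hE⟩ := X.exists_identities
    rw [hE]
    intro p hp
    exact hS p.1 p.2 (fun T _ hT => (hE T).1 (h T hT) p hp) (fun T _ hT => (hE T).1 (k T hT) p hp)

end SemigroupVariety

/-! ## Unary semigroups, epigroups and unary words -/

/-- A unary semigroup: a semigroup with an additional unary operation `bar`. -/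
class UnarySemigroup (S : Type u) extends Semigroup S where
  bar : S → S

open UnarySemigroup (bar)

/-- `a` lies in the maximal subgroup of `S` with unit element the idempotent `e`, which is the group
of units of the monoid `e S e`. Every subgroup of `S` with unit `e` is contained in it. -/
def InMaxSubgroup {S : Type u} [Semigroup S] (e a : S) : Prop :=
  e * e = e ∧ e * a = a ∧ a * e = a ∧ ∃ b : S, e * b = b ∧ b * e = b ∧ a * b = e ∧ b * a = e

/-- `y` is the pseudoinverse of `x`: some power of `x` lies in the maximal subgroup `G` with unit
`e`, and `y` is the inverse of `x e` in `G`. -/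
def IsPseudoinverse {S : Type u} [Semigroup S] (x y : S) : Prop :=
  ∃ e : S, (∃ n : ℕ, InMaxSubgroup e (spow x n)) ∧
    InMaxSubgroup e (x * e) ∧ InMaxSubgroup e y ∧ (x * e) * y = e ∧ y * (x * e) = e

/-- A unary semigroup is an epigroup (with its standard unary operation) if some power of every
element is a group element and the unary operation is pseudoinversion. -/
def IsEpigroup (S : Type u) [UnarySemigroup S] : Prop :=
  ∀ x : S, IsPseudoinverse x (bar x)

/-- Terms over the letters `0, 1, 2, …` in a binary and a unary operation symbol. -/
inductive UnaryTerm : Type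
  | letter : ℕ → UnaryTerm
  | mul : UnaryTerm → UnaryTerm → UnaryTerm
  | bar : UnaryTerm → UnaryTerm

namespace UnaryTerm

/-- The congruence on terms generated by associativity of multiplication. -/
inductive AssocEq : UnaryTerm → UnaryTerm → Prop
  | refl (s) : AssocEq s s
  | symm {s t} : AssocEq s t → AssocEq t s
  | trans {s t r} : AssocEq s t → AssocEq t r → AssocEq s r
  | assoc (s t r) : AssocEq (mul (mul s t) r) (mul s (mul t r))
  | mul {s s' t t'} : AssocEq s s' → AssocEq t t' → AssocEq (mul s t) (mul s' t')
  | bar {s s'} : AssocEq s s' → AssocEq (bar s) (bar s')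

instance setoid : Setoid UnaryTerm := ⟨AssocEq, AssocEq.refl, AssocEq.symm, AssocEq.trans⟩

/-- The value of a term in a unary semigroup. -/
def eval {S : Type u} [UnarySemigroup S] (φ : ℕ → S) : UnaryTerm → S
  | letter n => φ n
  | mul s t => eval φ s * eval φ t
  | bar s => UnarySemigroup.bar (eval φ s)

theorem eval_eq_of_assocEq {S : Type u} [UnarySemigroup S] (φ : ℕ → S) {s t : UnaryTerm}
    (h : AssocEq s t) : eval φ s = eval φ t := by
  induction h with
  | refl s => rfl
  | symm _ ih => exact ih.symm
  | trans _ _ ih ih' => exact ih.trans ih'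
  | assoc s t r => exact mul_assoc _ _ _
  | mul _ _ ih ih' => exact congrArg₂ (· * ·) ih ih'
  | bar _ ih => exact congrArg UnarySemigroup.bar ih

/-- The set of letters occurring in a term. -/
def alph : UnaryTerm → Finset ℕ
  | letter n => {n}
  | mul s t => alph s ∪ alph t
  | bar s => alph s

theorem alph_eq_of_assocEq {s t : UnaryTerm} (h : AssocEq s t) : alph s = alph t := by
  induction h with
  | refl s => rfl
  | symm _ ih => exact ih.symm
  | trans _ _ ih ih' => exact ih.trans ih'
  | assoc s t r => exact Finset.union_assoc _ _ _
  | mul _ _ ih ih' => exact congrArg₂ (· ∪ ·) ih ih'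
  | bar _ ih => exact ih

end UnaryTerm

/-- The free unary semigroup of countably infinite rank; its elements are the words of the theory of
epigroups. -/
def UnaryWord : Type := Quotient UnaryTerm.setoid

namespace UnaryWord

instance : UnarySemigroup UnaryWord where
  mul := Quotient.map₂ UnaryTerm.mul fun _ _ h _ _ k => UnaryTerm.AssocEq.mul h k
  mul_assoc := by
    rintro ⟨s⟩ ⟨t⟩ ⟨r⟩
    exact Quotient.sound (UnaryTerm.AssocEq.assoc s t r)
  bar := Quotient.map UnaryTerm.bar fun _ _ h => UnaryTerm.AssocEq.bar h

/-- The word consisting of a single letter. -/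
def letter (n : ℕ) : UnaryWord := Quotient.mk _ (UnaryTerm.letter n)

/-- The value of a word in a unary semigroup. -/
def eval {S : Type u} [UnarySemigroup S] (φ : ℕ → S) : UnaryWord → S :=
  Quotient.lift (UnaryTerm.eval φ) fun _ _ h => UnaryTerm.eval_eq_of_assocEq φ h

/-- The set of letters occurring in a word. -/
def alph : UnaryWord → Finset ℕ :=
  Quotient.lift UnaryTerm.alph fun _ _ h => UnaryTerm.alph_eq_of_assocEq h

/-- Letterwise renaming of a word. -/
def rename (f : ℕ → ℕ) (w : UnaryWord) : UnaryWord := eval (fun n => letter (f n)) w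

/-- The identity `u ≈ v` is substitutive: the two words have the same letters, and `v` is obtained
from `u` by renaming letters. -/
def IsSubstitutive (u v : UnaryWord) : Prop :=
  u.alph = v.alph ∧ ∃ σ : Equiv.Perm ℕ, v = u.rename σ

/-- The inclusion of the free semigroup in the free unary semigroup. -/
def ofWord : Word →ₙ* UnaryWord := FreeSemigroup.lift letter

theorem eval_mul {S : Type u} [UnarySemigroup S] (φ : ℕ → S) (u v : UnaryWord) :
    eval φ (u * v) = eval φ u * eval φ v := by
  obtain ⟨s⟩ := u
  obtain ⟨t⟩ := v
  rfl

theorem eval_bar {S : Type u} [UnarySemigroup S] (φ : ℕ → S) (u : UnaryWord) :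
    eval φ (bar u) = bar (eval φ u) := by
  obtain ⟨s⟩ := u
  rfl

theorem eval_letter {S : Type u} [UnarySemigroup S] (φ : ℕ → S) (n : ℕ) :
    eval φ (letter n) = φ n := rfl

theorem eval_ofWord {S : Type u} [UnarySemigroup S] (φ : ℕ → S) (u : Word) :
    eval φ (ofWord u) = FreeSemigroup.lift φ u := by
  have h : (MulHom.mk (eval φ) (eval_mul φ)).comp ofWord = FreeSemigroup.lift φ :=
    FreeSemigroup.hom_ext (by funext n; simp [ofWord, eval_letter])
  exact DFunLike.congr_fun h u

/-- The unary semigroup `S` satisfies the identity `u ≈ v`. -/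
def Satisfies (S : Type u) [UnarySemigroup S] (u v : UnaryWord) : Prop :=
  ∀ φ : ℕ → S, eval φ u = eval φ v

end UnaryWord

/-! ## Varieties of epigroups -/

/-- A variety of epigroups: the class of all unary semigroups satisfying some set of identities,
provided that all its members are epigroups. -/
structure EpigroupVariety : Type (u + 1) where
  Mem : ∀ (S : Type u) [UnarySemigroup S], Prop
  exists_identities : ∃ E : Set (UnaryWord × UnaryWord), ∀ (S : Type u) [UnarySemigroup S],
    Mem S ↔ ∀ p ∈ E, UnaryWord.Satisfies S p.1 p.2
  isEpigroup : ∀ (S : Type u) [UnarySemigroup S], Mem S → IsEpigroup S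

namespace EpigroupVariety

/-- The identity `u ≈ v` holds in `V`. -/
def Holds (V : EpigroupVariety.{u}) (u v : UnaryWord) : Prop :=
  ∀ (S : Type u) [UnarySemigroup S], V.Mem S → UnaryWord.Satisfies S u v

/-- The identity `u ≈ 0` holds in `V`: in every epigroup of `V` all values of `u` are equal to the
zero element. -/
def HoldsZero (V : EpigroupVariety.{u}) (u : UnaryWord) : Prop :=
  ∀ (S : Type u) [UnarySemigroup S], V.Mem S → ∀ φ : ℕ → S, IsZeroElement (UnaryWord.eval φ u)

/-- `V` is a nil-variety. (Lean's semigroups may be empty; the empty one is disregarded.) -/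
def IsNil (V : EpigroupVariety.{u}) : Prop :=
  ∀ (S : Type u) [UnarySemigroup S], V.Mem S → Nonempty S → IsNilSemigroup S

/-- The set `I(V)` of all semigroup words `u` such that `u ≈ 0` holds in `V`. -/
def zeroWords (V : EpigroupVariety.{u}) : Set Word := {u | V.HoldsZero (UnaryWord.ofWord u)}

/-- The fully invariant congruence on the free semigroup `F` corresponding to `V`: two semigroup
words are related when the identity between them holds in `V`. -/
def sim (V : EpigroupVariety.{u}) : FullyInvariantCon where
  r u v := V.Holds (UnaryWord.ofWord u) (UnaryWord.ofWord v)
  iseqv := ⟨fun _ _ _ _ _ => rfl, fun h S _ hS φ => (h S hS φ).symm,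
    fun h k S _ hS φ => (h S hS φ).trans (k S hS φ)⟩
  mul' := fun h k S _ hS φ => by
    rw [map_mul, map_mul, UnaryWord.eval_mul, UnaryWord.eval_mul, h S hS φ, k S hS φ]
  map_endo := fun ξ u v h S _ hS φ => by
    rw [UnaryWord.eval_ofWord, UnaryWord.eval_ofWord, SemigroupVariety.lift_endo,
      SemigroupVariety.lift_endo, ← UnaryWord.eval_ofWord, ← UnaryWord.eval_ofWord]
    exact h S hS _

theorem ext_mem {V W : EpigroupVariety.{u}}
    (h : ∀ (S : Type u) [UnarySemigroup S], V.Mem S ↔ W.Mem S) : V = W := by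
  obtain ⟨V, hV, _⟩ := V
  obtain ⟨W, hW, _⟩ := W
  have : @V = @W := by
    funext S inst
    exact propext (h S)
  subst this
  rfl

/-! The next facts show that the smallest class defined by identities and containing two given
varieties of epigroups consists of epigroups again, so that the join exists. -/

/-- The equations `x x̄ = x̄ x`, `x̄ x x̄ = x̄` and `x ^ (n + 2) x̄ = x ^ (n + 1)`. -/
def EpiEq {S : Type u} [UnarySemigroup S] (n : ℕ) (x : S) : Prop :=
  x * bar x = bar x * x ∧ bar x * x * bar x = bar x ∧ spow x (n + 1) * bar x = spow x n

theorem spow_comm {S : Type u} [Semigroup S] (x y : S) (h : x * y = y * x) (n : ℕ) :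
    spow x n * y = y * spow x n := by
  induction n with
  | zero => exact h
  | succ n ih => rw [spow, mul_assoc, h, ← mul_assoc, ih, mul_assoc]

theorem EpiEq.succ {S : Type u} [UnarySemigroup S] {n : ℕ} {x : S} (h : EpiEq n x) :
    EpiEq (n + 1) x := by
  obtain ⟨h1, h2, h3⟩ := h
  refine ⟨h1, h2, ?_⟩
  rw [spow, mul_assoc, h1, ← mul_assoc, h3, spow]

theorem EpiEq.mono {S : Type u} [UnarySemigroup S] {n m : ℕ} {x : S} (h : EpiEq n x)
    (hnm : n ≤ m) : EpiEq m x := by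
  induction hnm with
  | refl => exact h
  | step _ ih => exact ih.succ

theorem exists_epiEq {S : Type u} [UnarySemigroup S] {x : S} (h : IsPseudoinverse x (bar x)) :
    ∃ n, EpiEq n x := by
  obtain ⟨e, ⟨n, _, hp1, hp2, q, hq1, hq2, hpq, hqp⟩, _, ⟨_, hy1, hy2, _⟩, hxy, hyx⟩ := h
  generalize hy : bar x = y at *
  have hc : spow x n * x = x * spow x n := spow_comm x x rfl n
  generalize hp : spow x n = p at *
  have h1 : e * x = e * x * e := by
    calc e * x = q * (p * x) := by rw [← hqp, mul_assoc]
      _ = q * (x * (p * e)) := by rw [hc, hp2]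
      _ = q * (p * x) * e := by rw [hc]; simp only [mul_assoc]
      _ = e * x * e := by rw [← mul_assoc, hqp]
  have h2 : x * e = e * x * e := by
    calc x * e = p * x * q := by rw [hc, mul_assoc, hpq]
      _ = e * (p * x) * q := by rw [← mul_assoc e, hp1]
      _ = e * x * e := by rw [hc]; simp only [mul_assoc, hpq]
  have h3 : x * y = e := by rw [← hxy, mul_assoc, hy1]
  have h4 : y * x = e := by
    calc y * x = y * (e * x) := by rw [← mul_assoc, hy2]
      _ = e := by rw [h1, ← h2, hyx]
  refine ⟨n, ?_, ?_, ?_⟩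
  · rw [hy, h3, h4]
  · rw [hy, h4, hy1]
  · rw [hy, spow, hp, mul_assoc, h3, hp2]

theorem EpiEq.isPseudoinverse {S : Type u} [UnarySemigroup S] {n : ℕ} {x : S} (h : EpiEq n x) :
    IsPseudoinverse x (bar x) := by
  obtain ⟨h1, h2, h3⟩ := h
  generalize bar x = y at *
  have hxe : x * y * x = x * (x * y) := by rw [mul_assoc, h1]
  have hye : y * (x * y) = y := by rw [← mul_assoc, h2]
  have hey : x * y * y = y := by rw [h1, h2]
  have hee : x * y * (x * y) = x * y := by rw [mul_assoc, hye]
  have hk : ∀ k, spow x k * spow y k = x * y := by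
    intro k
    induction k with
    | zero => rfl
    | succ k ih =>
      calc spow x k * x * (spow y k * y) = spow x k * (x * spow y k) * y := by
            simp only [mul_assoc]
        _ = spow x k * spow y k * (x * y) := by
            rw [← spow_comm y x h1.symm k]; simp only [mul_assoc]
        _ = x * y := by rw [ih, hee]
  have hxyc : ∀ k, spow x k * spow y k = spow y k * spow x k := fun k =>
    spow_comm x _ (spow_comm y x h1.symm k).symm k
  have hp : spow x n * (x * y) = spow x n := by rw [← mul_assoc]; exact h3
  have hp' : x * y * spow x n = spow x n := by
    rw [← spow_comm x (x * y) hxe.symm n, hp]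
  have hqe : ∀ k, spow y k * (x * y) = spow y k := by
    intro k
    induction k with
    | zero => exact hye
    | succ k ih => rw [spow, mul_assoc, hye]
  have hq' : x * y * spow y n = spow y n := by
    rw [← spow_comm y (x * y) (by rw [hye, hey]) n, hqe]
  have a1 : x * (x * y) * y = x * y := by
    rw [← hxe, mul_assoc, hee]
  have a2 : y * (x * (x * y)) = x * y := by
    rw [← mul_assoc, ← h1, hee]
  have a3 : x * y * (x * (x * y)) = x * (x * y) := by
    rw [← mul_assoc, hxe, mul_assoc, hee]
  have a4 : x * (x * y) * (x * y) = x * (x * y) := by rw [mul_assoc, hee]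
  exact ⟨x * y, ⟨n, hee, hp', hp, spow y n, hq', hqe n, hk n, by rw [← hxyc, hk]⟩,
    ⟨hee, a3, a4, y, hey, hye, a1, a2⟩,
    ⟨hee, hey, hye, x * (x * y), a3, a4, a2, a1⟩, a1, a2⟩

instance piUnarySemigroup {ι : Type} (S : ι → Type u) [∀ i, UnarySemigroup (S i)] :
    UnarySemigroup (∀ i, S i) where
  bar x i := bar (x i)

theorem eval_pi {ι : Type} (S : ι → Type u) [∀ i, UnarySemigroup (S i)] (φ : ℕ → ∀ i, S i)
    (w : UnaryWord) (i : ι) :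
    UnaryWord.eval φ w i = UnaryWord.eval (fun n => φ n i) w := by
  obtain ⟨t⟩ := w
  change UnaryTerm.eval φ t i = UnaryTerm.eval (fun n => φ n i) t
  induction t with
  | letter n => rfl
  | mul s t ih ih' => exact congrArg₂ (· * ·) ih ih'
  | bar s ih => exact congrArg bar ih

theorem spow_pi {ι : Type} (S : ι → Type u) [∀ i, UnarySemigroup (S i)] (x : ∀ i, S i)
    (n : ℕ) (i : ι) : spow x n i = spow (x i) n := by
  induction n with
  | zero => rfl
  | succ n ih => exact congrArg (· * x i) ih

theorem exists_uniform (V : EpigroupVariety.{u}) :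
    ∃ n, ∀ (S : Type u) [UnarySemigroup S], V.Mem S → ∀ x : S, EpiEq n x := by
  by_contra hcon
  push Not at hcon
  choose S inst hS x hx using hcon
  obtain ⟨E, hE⟩ := V.exists_identities
  have hmem : V.Mem (∀ n, S n) := by
    rw [hE]
    intro p hp φ
    funext i
    rw [eval_pi, eval_pi]
    exact (hE (S i)).1 (hS i) p hp _
  obtain ⟨n, h1, h2, h3⟩ := exists_epiEq (V.isEpigroup _ hmem x)
  refine hx n ⟨congrFun h1 n, congrFun h2 n, ?_⟩
  have h := congrFun h3 n
  rw [spow_pi, Pi.mul_apply, spow_pi] at h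
  exact h

theorem eval_spow {S : Type u} [UnarySemigroup S] (φ : ℕ → S) (w : UnaryWord) (n : ℕ) :
    UnaryWord.eval φ (spow w n) = spow (UnaryWord.eval φ w) n := by
  induction n with
  | zero => rfl
  | succ n ih => rw [spow, spow, UnaryWord.eval_mul, ih]

theorem isEpigroup_of_holds (V W : EpigroupVariety.{u}) (S : Type u) [UnarySemigroup S]
    (hS : ∀ u v : UnaryWord, V.Holds u v → W.Holds u v → UnaryWord.Satisfies S u v) :
    IsEpigroup S := by
  obtain ⟨n, hn⟩ := V.exists_uniform
  obtain ⟨m, hm⟩ := W.exists_uniform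
  have hV : ∀ (T : Type u) [UnarySemigroup T], V.Mem T → ∀ x : T, EpiEq (max n m) x :=
    fun T _ hT x => (hn T hT x).mono (le_max_left _ _)
  have hW : ∀ (T : Type u) [UnarySemigroup T], W.Mem T → ∀ x : T, EpiEq (max n m) x :=
    fun T _ hT x => (hm T hT x).mono (le_max_right _ _)
  generalize max n m = k at hV hW
  have key : ∀ u v : UnaryWord,
      (∀ (T : Type u) [UnarySemigroup T] (φ : ℕ → T), EpiEq k (φ 0) →
        UnaryWord.eval φ u = UnaryWord.eval φ v) → UnaryWord.Satisfies S u v :=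
    fun u v h => hS u v (fun T _ hT φ => h T φ (hV T hT _)) (fun T _ hT φ => h T φ (hW T hT _))
  intro x
  let a := UnaryWord.letter 0
  have e1 := key (a * bar a) (bar a * a) (fun T _ φ h => by
    simp only [UnaryWord.eval_mul, UnaryWord.eval_bar, a, UnaryWord.eval_letter]
    exact h.1) (fun _ => x)
  have e2 := key (bar a * a * bar a) (bar a) (fun T _ φ h => by
    simp only [UnaryWord.eval_mul, UnaryWord.eval_bar, a, UnaryWord.eval_letter]
    exact h.2.1) (fun _ => x)
  have e3 := key (spow a (k + 1) * bar a) (spow a k) (fun T _ φ h => by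
    simp only [UnaryWord.eval_mul, UnaryWord.eval_bar, eval_spow, a, UnaryWord.eval_letter]
    exact h.2.2) (fun _ => x)
  simp only [UnaryWord.eval_mul, UnaryWord.eval_bar, eval_spow, a, UnaryWord.eval_letter]
    at e1 e2 e3
  exact EpiEq.isPseudoinverse (n := k) ⟨e1, e2, e3⟩

/-- The lattice of all epigroup varieties, ordered by inclusion of classes. The meet is the
intersection of classes, and the join is the class defined by all identities that hold in both. -/
instance : Lattice EpigroupVariety.{u} where
  le V W := ∀ (S : Type u) [UnarySemigroup S], V.Mem S → W.Mem S
  le_refl _ _ _ h := h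
  le_trans _ _ _ h k S _ hS := k S (h S hS)
  le_antisymm _ _ h k := ext_mem fun S _ => ⟨h S, k S⟩
  inf V W :=
    { Mem := fun S _ => V.Mem S ∧ W.Mem S
      exists_identities := by
        obtain ⟨E, hE⟩ := V.exists_identities
        obtain ⟨E', hE'⟩ := W.exists_identities
        refine ⟨E ∪ E', fun S _ => ?_⟩
        rw [hE, hE']
        simp only [Set.mem_union, or_imp, forall_and]
      isEpigroup := fun S _ h => V.isEpigroup S h.1 }
  inf_le_left _ _ _ _ h := h.1
  inf_le_right _ _ _ _ h := h.2
  le_inf _ _ _ h k S _ hS := ⟨h S hS, k S hS⟩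
  sup V W :=
    { Mem := fun S _ => ∀ u v : UnaryWord, V.Holds u v → W.Holds u v → UnaryWord.Satisfies S u v
      exists_identities := ⟨{p | V.Holds p.1 p.2 ∧ W.Holds p.1 p.2}, fun S _ =>
        ⟨fun h p hp => h p.1 p.2 hp.1 hp.2, fun h u v hu hv => h (u, v) ⟨hu, hv⟩⟩⟩
      isEpigroup := fun S _ h => isEpigroup_of_holds V W S h }
  le_sup_left _ _ S _ hS _ _ h _ := h S hS
  le_sup_right _ _ S _ hS _ _ _ h := h S hS
  sup_le V W X h k S _ hS := by
    obtain ⟨E, hE⟩ := X.exists_identities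
    rw [hE]
    intro p hp
    exact hS p.1 p.2 (fun T _ hT => (hE T).1 (h T hT) p hp) (fun T _ hT => (hE T).1 (k T hT) p hp)

end EpigroupVariety

end SemigroupVarieties

open SemigroupVarieties

/-!
Both lattices of varieties are dual to lattices of fully invariant congruences, and modularity is a
self-dual notion. Let `ν` be the fully invariant congruence on `F` of a nil-variety `V`. The variety
satisfies `x ^ (n + 1) ≈ 0` for some `n`. For fully invariant congruences `z ≤ y` modularity of `V`
gives `(ν ∨ z) ∧ y ≤ (ν ∧ y) ∨ z`. For varieties of semigroups this holds for all such `y` and `z`;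
for varieties of epigroups it holds at least when `z` contains `x ^ (k + 1) ≈ x ^ (k + 2)` for some
`k`, because then `y` and `z` define varieties of epigroups in which pseudoinversion is a power.
This restricted law is `FullyInvariantCon.PeriodicModular`, and both parts of the result follow from
it, for semigroups and epigroups alike. In an epigroup nil-variety pseudoinverses are zero, so the
words that are not zero are semigroup words (`EpigroupVariety.exists_eq_ofWord`).

Identities of nonzero words (`FullyInvariantCon.below_of_related`). Let `u ν v` be nonzero words with
`|u| ≤ |v|`, and suppose that `v` is not below `u`. Take for `y` the equality of prefixes of length
`|u|`, and for `z` its restriction to the ideal of words above `v`. With `s = x ^ (n + 1)` the chain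
`u ν v z v s ν u s` and `u y u s` show that `(ν ∨ z) ∧ y` relates `u` to `u s`. But `(ν ∧ y) ∨ z`
relates `u` to itself only: `z` does because `u` is not above `v`, and a word related to `u` by
`ν ∧ y` has the form `u t`, where a nonempty `t` would give `u ν u t ν u t ^ 2 ν …` and so `u ≈ 0`.
Hence `v` is below `u`; both words have the same letters, so `v` is a renaming of `u`.

Check sets (`FullyInvariantCon.isModularElement_restrict`). A congruence `β` of the check set `M`
extends to the largest fully invariant congruence that is contained in the equivalence which is `β`
on `M` and total outside `M`. The definition of a check set ensures that this extension restricts to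
`β` itself (`FullyInvariantCon.syntacticCon_of_related`). As `M` is a union of classes of the
extensions, the chains witnessing a relation in `(ν ∧ y) ∨ z` between words of `M` stay in `M`, and
the modular law for the extensions yields the one for `ν` restricted to `M`. Words of `M` are not
zero in `V`, so powers of words with an exponent greater than `n` do not occur in them, which makes
the extensions periodic.
-/

namespace SemigroupVarieties

/-! ### Words as lists of letters -/

/-- The list of letters of a semigroup word, in order. -/
def wordList (w : Word) : List ℕ := w.head :: w.tail

theorem wordList_mul (u v : Word) : wordList (u * v) = wordList u ++ wordList v := rfl

theorem wordList_of (n : ℕ) : wordList (FreeSemigroup.of n) = [n] := rfl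

theorem wordList_ne_nil (w : Word) : wordList w ≠ [] := List.cons_ne_nil _ _

theorem wordList_injective : Function.Injective wordList := by
  rintro ⟨a, s⟩ ⟨b, t⟩ h
  obtain ⟨rfl, rfl⟩ := List.cons.inj h
  rfl

theorem exists_wordList_eq {l : List ℕ} (hl : l ≠ []) : ∃ w : Word, wordList w = l := by
  obtain ⟨a, s, rfl⟩ := List.exists_cons_of_ne_nil hl
  exact ⟨⟨a, s⟩, rfl⟩

theorem mem_alph_iff {n : ℕ} {w : Word} : n ∈ w.alph ↔ n ∈ wordList w := List.mem_toFinset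

theorem wordList_endo (ξ : Word →ₙ* Word) (w : Word) :
    wordList (ξ w) = (wordList w).flatMap fun n => wordList (ξ (FreeSemigroup.of n)) := by
  induction w using FreeSemigroup.recOnMul with
  | ih1 n => simp [wordList_of]
  | ih2 n w h1 h2 => rw [map_mul, wordList_mul, wordList_mul, List.flatMap_append, ← h2, ← h1]

theorem wordList_rename (f : ℕ → ℕ) (w : Word) :
    wordList (w.rename f) = (wordList w).map f := by
  rw [Word.rename, wordList_endo]
  simp [wordList_of, List.map_eq_flatMap]

theorem below_iff {u v : Word} :
    u.Below v ↔ ∃ (ξ : Word →ₙ* Word) (a b : List ℕ), wordList v = a ++ wordList (ξ u) ++ b := by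
  constructor
  · rintro ⟨ξ, a, b, h⟩
    refine ⟨ξ, ?_⟩
    induction a using WithOne.recOneCoe with
    | one =>
      induction b using WithOne.recOneCoe with
      | one =>
        rw [one_mul, mul_one, WithOne.coe_inj] at h
        exact ⟨[], [], by simp [h]⟩
      | coe b =>
        rw [one_mul, ← WithOne.coe_mul, WithOne.coe_inj] at h
        exact ⟨[], wordList b, by simp [h, wordList_mul]⟩
    | coe a =>
      induction b using WithOne.recOneCoe with
      | one =>
        rw [mul_one, ← WithOne.coe_mul, WithOne.coe_inj] at h
        exact ⟨wordList a, [], by simp [h, wordList_mul]⟩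
      | coe b =>
        rw [← WithOne.coe_mul, ← WithOne.coe_mul, WithOne.coe_inj] at h
        exact ⟨wordList a, wordList b, by simp [h, wordList_mul]⟩
  · rintro ⟨ξ, a, b, h⟩
    have key : ∀ l : List ℕ, ∃ s : WithOne Word, ∀ w : Word,
        (∃ p : Word, wordList p = l ++ wordList w ∧ (p : WithOne Word) = s * w) ∧
        (∃ p : Word, wordList p = wordList w ++ l ∧ (p : WithOne Word) = w * s) := by
      intro l
      rcases eq_or_ne l [] with rfl | hl
      · exact ⟨1, fun w => ⟨⟨w, by simp⟩, ⟨w, by simp⟩⟩⟩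
      · obtain ⟨s, rfl⟩ := exists_wordList_eq hl
        exact ⟨s, fun w => ⟨⟨s * w, rfl, WithOne.coe_mul _ _⟩, ⟨w * s, rfl, WithOne.coe_mul _ _⟩⟩⟩
    obtain ⟨s, hs⟩ := key a
    obtain ⟨t, ht⟩ := key b
    obtain ⟨p, hp, hp'⟩ := (hs (ξ u)).1
    obtain ⟨q, hq, hq'⟩ := (ht p).2
    refine ⟨ξ, s, t, ?_⟩
    rw [← hp', ← hq', WithOne.coe_inj]
    exact wordList_injective (by rw [h, hq, hp])

theorem length_le_length_endo (ξ : Word →ₙ* Word) (u : Word) :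
    (wordList u).length ≤ (wordList (ξ u)).length := by
  rw [wordList_endo]
  induction wordList u with
  | nil => simp
  | cons n l ih =>
    have := List.length_pos_iff.2 (wordList_ne_nil (ξ (FreeSemigroup.of n)))
    simp only [List.flatMap_cons, List.length_append, List.length_cons]
    omega

theorem Word.Below.length_le {u v : Word} (h : u.Below v) :
    (wordList u).length ≤ (wordList v).length := by
  obtain ⟨ξ, a, b, h⟩ := below_iff.1 h
  have := length_le_length_endo ξ u
  simp only [h, List.length_append]
  omega

theorem Word.Below.mul_right {u v : Word} (h : u.Below v) (w : Word) : u.Below (v * w) := by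
  obtain ⟨ξ, a, b, h⟩ := below_iff.1 h
  exact below_iff.2 ⟨ξ, a, b ++ wordList w, by simp [wordList_mul, h]⟩

theorem Word.Below.mul_left {u v : Word} (h : u.Below v) (w : Word) : u.Below (w * v) := by
  obtain ⟨ξ, a, b, h⟩ := below_iff.1 h
  exact below_iff.2 ⟨ξ, wordList w ++ a, b, by simp [wordList_mul, h]⟩

theorem Word.Below.endo {u v : Word} (h : u.Below v) (η : Word →ₙ* Word) : u.Below (η v) := by
  obtain ⟨ξ, a, b, h⟩ := below_iff.1 h
  refine below_iff.2 ⟨η.comp ξ, a.flatMap fun n => wordList (η (FreeSemigroup.of n)),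
    b.flatMap fun n => wordList (η (FreeSemigroup.of n)), ?_⟩
  rw [wordList_endo, h, List.flatMap_append, List.flatMap_append, ← wordList_endo]
  rfl

theorem Word.Below.refl (u : Word) : u.Below u :=
  below_iff.2 ⟨MulHom.id Word, [], [], by simp⟩

theorem endo_eq_rename (ξ : Word →ₙ* Word) (f : ℕ → ℕ) (u : Word)
    (h : ∀ n ∈ u.alph, ξ (FreeSemigroup.of n) = FreeSemigroup.of (f n)) : ξ u = u.rename f := by
  apply wordList_injective
  rw [wordList_rename, wordList_endo, List.map_eq_flatMap]
  refine List.flatMap_congr fun n hn => ?_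
  rw [h n (mem_alph_iff.2 hn), wordList_of]

/-- An endomorphism that does not lengthen `u` and keeps its letters acts on `u` as a permutation of
these letters. -/
theorem exists_perm_of_length_le (ξ : Word →ₙ* Word) (u : Word)
    (hlen : (wordList (ξ u)).length ≤ (wordList u).length) (halph : (ξ u).alph = u.alph) :
    ∃ σ : Equiv.Perm u.alph, ∀ n (hn : n ∈ u.alph),
      ξ (FreeSemigroup.of n) = FreeSemigroup.of (σ ⟨n, hn⟩ : ℕ) := by
  have h1 : ∀ n ∈ u.alph, (wordList (ξ (FreeSemigroup.of n))).length = 1 := by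
    rw [wordList_endo] at hlen
    intro n hn
    rw [mem_alph_iff] at hn
    have hle : ∀ l : List ℕ, l.length ≤
        (l.flatMap fun n => wordList (ξ (FreeSemigroup.of n))).length := by
      intro l
      induction l with
      | nil => simp
      | cons n l ih =>
        have := List.length_pos_iff.2 (wordList_ne_nil (ξ (FreeSemigroup.of n)))
        simp only [List.flatMap_cons, List.length_append, List.length_cons]
        omega
    obtain ⟨s, t, hst⟩ := List.append_of_mem hn
    rw [hst] at hlen
    have hs := hle s
    have ht := hle t
    have := List.length_pos_iff.2 (wordList_ne_nil (ξ (FreeSemigroup.of n)))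
    simp only [List.flatMap_append, List.flatMap_cons, List.length_append, List.length_cons] at hlen
    omega
  have h2 : ∀ n ∈ u.alph, ∃ m, ξ (FreeSemigroup.of n) = FreeSemigroup.of m := by
    intro n hn
    obtain ⟨m, hm⟩ := List.length_eq_one_iff.1 (h1 n hn)
    exact ⟨m, wordList_injective hm⟩
  choose! f hf using h2
  have hmaps : u.alph.image f = u.alph := by
    rw [← alph_rename, ← endo_eq_rename ξ f u hf, halph]
  have hinj : Set.InjOn f u.alph := by
    rw [← Finset.card_image_iff, hmaps]
  have hmem : ∀ n ∈ u.alph, f n ∈ u.alph := fun n hn => by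
    rw [← hmaps]
    exact Finset.mem_image_of_mem f hn
  let g : u.alph → u.alph := fun n => ⟨f n, hmem n n.2⟩
  have hg : Function.Injective g := fun a b hab =>
    Subtype.ext (hinj a.2 b.2 (congrArg Subtype.val hab))
  exact ⟨Equiv.ofBijective g (Finite.injective_iff_bijective.1 hg), hf⟩

/-- A word that lies below another one with the same letters and is at least as long is obtained
from it by renaming letters. -/
theorem isSubstitutive_of_below {u v : Word} (h : u.Below v) (halph : u.alph = v.alph)
    (hlen : (wordList v).length ≤ (wordList u).length) : IsSubstitutive u v := by
  obtain ⟨ξ, a, b, hab⟩ := below_iff.1 h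
  have hle := length_le_length_endo ξ u
  have hl := congrArg List.length hab
  simp only [List.length_append] at hl
  obtain rfl : a = [] := List.length_eq_zero_iff.1 (by omega)
  obtain rfl : b = [] := List.length_eq_zero_iff.1 (by omega)
  obtain rfl : v = ξ u := wordList_injective (by simpa using hab)
  obtain ⟨σ, hσ⟩ := exists_perm_of_length_le ξ u hlen halph.symm
  refine ⟨halph, Equiv.Perm.ofSubtype σ, endo_eq_rename ξ _ u fun n hn => ?_⟩
  rw [Equiv.Perm.ofSubtype_apply_of_mem σ hn]
  exact hσ n hn

theorem IsSubstitutive.symm {u v : Word} (h : IsSubstitutive u v) : IsSubstitutive v u := by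
  obtain ⟨h, σ, rfl⟩ := h
  refine ⟨h.symm, σ⁻¹, ?_⟩
  rw [rename_rename, ← Equiv.Perm.coe_mul, inv_mul_cancel]
  exact (rename_id u).symm

theorem map_spow {S T : Type*} [Mul S] [Mul T] (f : S →ₙ* T) (x : S) (n : ℕ) :
    f (spow x n) = spow (f x) n := by
  induction n with
  | zero => rfl
  | succ n ih => rw [spow, spow, map_mul, ih]

theorem wordList_spow (x n : ℕ) :
    wordList (spow (FreeSemigroup.of x) n) = List.replicate (n + 1) x := by
  induction n with
  | zero => rfl
  | succ n ih => rw [spow, wordList_mul, ih, wordList_of, List.replicate_succ' (n := n + 1)]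

/-- Identifying all letters shows that a word lies below every sufficiently high power. -/
theorem below_spow (u : Word) {n : ℕ} (hn : (wordList u).length ≤ n) :
    u.Below (spow (FreeSemigroup.of 0) n) := by
  refine below_iff.2 ⟨FreeSemigroup.map fun _ => 0, [],
    List.replicate (n + 1 - (wordList u).length) 0, ?_⟩
  rw [wordList_spow, ← Word.rename, wordList_rename, List.map_const', List.nil_append,
    List.replicate_append_replicate]
  congr 1
  omega

/-! ### Fully invariant congruences -/

namespace FullyInvariantCon

theorem refl (c : FullyInvariantCon) (p : Word) : c.toCon p p := c.toCon.refl p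

theorem trans (c : FullyInvariantCon) {p q r : Word} (h : c.toCon p q) (k : c.toCon q r) :
    c.toCon p r := c.toCon.trans h k

theorem symm (c : FullyInvariantCon) {p q : Word} (h : c.toCon p q) : c.toCon q p :=
  c.toCon.symm h

/-- The intersection of two fully invariant congruences. -/
def inf (c d : FullyInvariantCon) : FullyInvariantCon where
  toCon := c.toCon ⊓ d.toCon
  map_endo ξ u v h := ⟨c.map_endo ξ u v h.1, d.map_endo ξ u v h.2⟩

theorem setoid_sup_map {α : Type*} {s t : Setoid α} (f : α → α)
    (hs : ∀ p q, s p q → s (f p) (f q)) (ht : ∀ p q, t p q → t (f p) (f q)) {p q : α}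
    (h : (s ⊔ t) p q) : (s ⊔ t) (f p) (f q) := by
  have key : s ⊔ t ≤ (s ⊔ t).comap f := sup_le
    (fun {a b} hab => (le_sup_left : s ≤ s ⊔ t) (hs a b hab))
    (fun {a b} hab => (le_sup_right : t ≤ s ⊔ t) (ht a b hab))
  exact key h

/-- The join of two fully invariant congruences; it is their join as equivalence relations. -/
def sup (c d : FullyInvariantCon) : FullyInvariantCon where
  toSetoid := c.toSetoid ⊔ d.toSetoid
  mul' {w x y z} h k := by
    refine Setoid.trans' _ (setoid_sup_map (· * y) ?_ ?_ h) (setoid_sup_map (x * ·) ?_ ?_ k)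
    · exact fun p q h => c.toCon.mul h (c.refl y)
    · exact fun p q h => d.toCon.mul h (d.refl y)
    · exact fun p q h => c.toCon.mul (c.refl x) h
    · exact fun p q h => d.toCon.mul (d.refl x) h
  map_endo ξ _ _ h := setoid_sup_map ξ (c.map_endo ξ) (d.map_endo ξ) h

theorem sup_left {c d : FullyInvariantCon} {p q : Word} (h : c.toCon p q) :
    (c.sup d).toCon p q :=
  (le_sup_left : c.toSetoid ≤ c.toSetoid ⊔ d.toSetoid) h

theorem sup_right {c d : FullyInvariantCon} {p q : Word} (h : d.toCon p q) :
    (c.sup d).toCon p q :=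
  (le_sup_right : d.toSetoid ≤ c.toSetoid ⊔ d.toSetoid) h

theorem sup_rec {c d : FullyInvariantCon} (s : Setoid Word) (hc : ∀ p q, c.toCon p q → s p q)
    (hd : ∀ p q, d.toCon p q → s p q) {p q : Word} (h : (c.sup d).toCon p q) : s p q := by
  have key : c.toSetoid ⊔ d.toSetoid ≤ s := sup_le (fun {a b} => hc a b) (fun {a b} => hd a b)
  exact key h

/-- The class of `u` is the zero of the quotient of `F` by `c`. -/
def IsZeroWord (c : FullyInvariantCon) (u : Word) : Prop :=
  ∀ p : Word, c.toCon (u * p) u ∧ c.toCon (p * u) u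

variable {c : FullyInvariantCon}

theorem IsZeroWord.congr {u v : Word} (hv : c.IsZeroWord v) (h : c.toCon u v) :
    c.IsZeroWord u := fun p =>
  ⟨c.trans (c.toCon.mul h (c.refl p)) (c.trans (hv p).1 (c.symm h)),
    c.trans (c.toCon.mul (c.refl p) h) (c.trans (hv p).2 (c.symm h))⟩

theorem IsZeroWord.related {u v : Word} (hu : c.IsZeroWord u) (hv : c.IsZeroWord v) :
    c.toCon u v := c.trans (c.symm (hu v).1) (hv u).2

theorem IsZeroWord.mul_right {u : Word} (hu : c.IsZeroWord u) (w : Word) :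
    c.IsZeroWord (u * w) := hu.congr (hu w).1

theorem IsZeroWord.mul_left {u : Word} (hu : c.IsZeroWord u) (w : Word) :
    c.IsZeroWord (w * u) := hu.congr (hu w).2

theorem IsZeroWord.of_infix {u v : Word} (hu : c.IsZeroWord u) {a b : List ℕ}
    (h : wordList v = a ++ wordList u ++ b) : c.IsZeroWord v := by
  have h1 : ∃ p, c.IsZeroWord p ∧ wordList p = a ++ wordList u := by
    rcases eq_or_ne a [] with rfl | ha
    · exact ⟨u, hu, rfl⟩
    · obtain ⟨s, rfl⟩ := exists_wordList_eq ha
      exact ⟨s * u, hu.mul_left s, rfl⟩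
  obtain ⟨p, hp, hp'⟩ := h1
  rw [← hp'] at h
  rcases eq_or_ne b [] with rfl | hb
  · rw [List.append_nil] at h
    rwa [wordList_injective h]
  · obtain ⟨t, rfl⟩ := exists_wordList_eq hb
    rw [← wordList_mul] at h
    rw [wordList_injective h]
    exact hp.mul_right t

/-- A power of a letter that is zero stays zero when a word is substituted for the letter. -/
theorem IsZeroWord.spow {n : ℕ} (h : c.IsZeroWord (spow (FreeSemigroup.of 0) n)) (w : Word) :
    c.IsZeroWord (SemigroupVarieties.spow w n) := by
  intro p
  -- The letter `1` stands for the arbitrary factor `p`.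
  let ξ : Word →ₙ* Word := FreeSemigroup.lift fun i => if i = 0 then w else p
  have h1 := c.map_endo ξ _ _ (h (FreeSemigroup.of 1)).1
  have h2 := c.map_endo ξ _ _ (h (FreeSemigroup.of 1)).2
  have h3 : ξ (SemigroupVarieties.spow (FreeSemigroup.of 0) n) = SemigroupVarieties.spow w n := by
    rw [map_spow]
    rfl
  rw [map_mul, h3] at h1 h2
  exact ⟨h1, h2⟩

theorem IsZeroWord.spow_of_le {n k : ℕ} {w : Word} (h : c.IsZeroWord (SemigroupVarieties.spow w n))
    (hk : n ≤ k) : c.IsZeroWord (SemigroupVarieties.spow w k) := by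
  induction hk with
  | refl => exact h
  | step _ ih => exact ih.mul_right w

theorem isZeroWord_of_related_mul {n : ℕ} (h : c.IsZeroWord (spow (FreeSemigroup.of 0) n))
    {u s : Word} (hus : c.toCon u (u * s)) : c.IsZeroWord u := by
  have key : ∀ k, c.toCon u (u * SemigroupVarieties.spow s k) := by
    intro k
    induction k with
    | zero => exact hus
    | succ k ih =>
      rw [SemigroupVarieties.spow, ← mul_assoc]
      exact c.trans hus (c.toCon.mul ih (c.refl s))
  exact ((h.spow s).mul_left u).congr (key n)

theorem alph_subset_of_related {n : ℕ} (h : c.IsZeroWord (spow (FreeSemigroup.of 0) n))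
    {u v : Word} (huv : c.toCon u v) (hu : ¬ c.IsZeroWord u) : v.alph ⊆ u.alph := by
  intro x hx
  by_contra hxu
  -- Substituting a zero power for `x` fixes `u` and annihilates `v`.
  let ξ : Word →ₙ* Word := FreeSemigroup.lift fun i =>
    if i = x then SemigroupVarieties.spow (FreeSemigroup.of 0) n else FreeSemigroup.of i
  have hξu : ξ u = u := by
    rw [endo_eq_rename ξ id u, rename_id]
    intro i hi
    have hix : i ≠ x := fun e => hxu (e ▸ hi)
    simp [ξ, hix]
  have hξx : ξ (FreeSemigroup.of x) = SemigroupVarieties.spow (FreeSemigroup.of 0) n := by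
    simp [ξ]
  obtain ⟨s, t, hst⟩ := List.append_of_mem (mem_alph_iff.1 hx)
  have hξv := wordList_endo ξ v
  rw [hst, List.flatMap_append, List.flatMap_cons, ← List.append_assoc, hξx] at hξv
  have h1 := c.map_endo ξ u v huv
  rw [hξu] at h1
  exact hu ((h.of_infix hξv).congr h1)

theorem alph_eq_of_related {n : ℕ} (h : c.IsZeroWord (spow (FreeSemigroup.of 0) n))
    {u v : Word} (huv : c.toCon u v) (hu : ¬ c.IsZeroWord u) : u.alph = v.alph :=
  (alph_subset_of_related h (c.symm huv) fun hv => hu (hv.congr huv)).antisymm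
    (alph_subset_of_related h huv hu)

/-! ### Identities of nonzero words are substitutive -/

/-- The modular law for `ν` in the lattice of fully invariant congruences on `F`, restricted to
pairs `z ≤ y` for which the quotient of `F` by `z` is periodic with trivial subgroups. This is the
part of the modular law that varieties of semigroups and varieties of epigroups have in common. -/
def PeriodicModular (ν : FullyInvariantCon) : Prop :=
  ∀ y z : FullyInvariantCon, (∀ p q, z.toCon p q → y.toCon p q) →
    (∃ k, z.toCon (spow (FreeSemigroup.of 0) k) (spow (FreeSemigroup.of 0) (k + 1))) →
    ∀ p q, (ν.sup z).toCon p q → y.toCon p q → ((ν.inf y).sup z).toCon p q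

theorem take_append_congr {r : ℕ} {a a' b b' : List ℕ} (ha : a.take r = a'.take r)
    (hb : b.take r = b'.take r) : (a ++ b).take r = (a' ++ b').take r := by
  have key : ∀ a b : List ℕ, (a ++ b).take r = (a.take r ++ b.take r).take r := by
    intro a b
    rw [List.take_append, List.take_append, List.take_take, List.take_take, List.length_take]
    rcases le_total r a.length with h | h
    · simp [h]
    · simp [h]
  rw [key a b, key a' b', ha, hb]

theorem take_flatMap {f : ℕ → List ℕ} (hf : ∀ n, f n ≠ []) (r : ℕ) (l : List ℕ) :
    (l.flatMap f).take r = ((l.take r).flatMap f).take r := by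
  induction l generalizing r with
  | nil => simp
  | cons n l ih =>
    cases r with
    | zero => simp
    | succ r =>
      have hpos := List.length_pos_iff.2 (hf n)
      have h : ∀ l : List ℕ, l.take (r + 1 - (f n).length) =
          (l.take r).take (r + 1 - (f n).length) := fun l => by
        rw [List.take_take, min_eq_left (by omega)]
      rw [List.take_succ_cons, List.flatMap_cons, List.flatMap_cons, List.take_append,
        List.take_append, h, ih r, ← h]

/-- Words are related if they have the same prefix of length `r`; a word with fewer than `r` letters
is related to itself only. -/
def prefixCon (r : ℕ) : FullyInvariantCon where
  r u v := (wordList u).take r = (wordList v).take r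
  iseqv := ⟨fun _ => rfl, Eq.symm, Eq.trans⟩
  mul' h k := take_append_congr h k
  map_endo ξ u v h := by
    change (wordList (ξ u)).take r = (wordList (ξ v)).take r
    change (wordList u).take r = (wordList v).take r at h
    have hne : ∀ n, wordList (ξ (FreeSemigroup.of n)) ≠ [] := fun n => wordList_ne_nil _
    rw [wordList_endo, wordList_endo, take_flatMap hne, h, ← take_flatMap hne]

/-- The restriction of `c` to the fully invariant ideal of all words above `v`, extended by
equality. -/
def restrictAbove (c : FullyInvariantCon) (v : Word) : FullyInvariantCon where
  r p q := p = q ∨ v.Below p ∧ v.Below q ∧ c.toCon p q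
  iseqv := by
    refine ⟨fun _ => Or.inl rfl, ?_, ?_⟩
    · rintro p q (rfl | ⟨hp, hq, h⟩)
      · exact Or.inl rfl
      · exact Or.inr ⟨hq, hp, c.symm h⟩
    · rintro p q r (rfl | ⟨hp, hq, h⟩) (rfl | ⟨hq', hr, k⟩)
      · exact Or.inl rfl
      · exact Or.inr ⟨hq', hr, k⟩
      · exact Or.inr ⟨hp, hq, h⟩
      · exact Or.inr ⟨hp, hr, c.trans h k⟩
  mul' := by
    rintro p q r s (rfl | ⟨hp, hq, h⟩) (rfl | ⟨hr, hs, k⟩)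
    · exact Or.inl rfl
    · exact Or.inr ⟨hr.mul_left _, hs.mul_left _, c.toCon.mul (c.refl _) k⟩
    · exact Or.inr ⟨hp.mul_right _, hq.mul_right _, c.toCon.mul h (c.refl _)⟩
    · exact Or.inr ⟨hp.mul_right _, hq.mul_right _, c.toCon.mul h k⟩
  map_endo := by
    rintro ξ p q (rfl | ⟨hp, hq, h⟩)
    · exact Or.inl rfl
    · exact Or.inr ⟨hp.endo ξ, hq.endo ξ, c.map_endo ξ _ _ h⟩

/-- If `v` were not below a shorter or equally long `u`, then for `y` the equality of prefixes of
length `|u|` and `z` its restriction to the words above `v`, the word `u` would be isolated in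
`(ν ∧ y) ∨ z`, although `(ν ∨ z) ∧ y` relates it to `u x ^ (n + 1)`. -/
theorem below_of_related {ν : FullyInvariantCon} {n : ℕ}
    (hn : ν.IsZeroWord (spow (FreeSemigroup.of 0) n)) (hmod : ν.PeriodicModular) {u v : Word}
    (huv : ν.toCon u v) (hu : ¬ ν.IsZeroWord u)
    (hlen : (wordList u).length ≤ (wordList v).length) : v.Below u := by
  by_contra hvu
  let s : Word := SemigroupVarieties.spow (FreeSemigroup.of 0) n
  let y := prefixCon (wordList u).length
  let z := y.restrictAbove v
  have hy : ∀ w, (wordList u).length ≤ (wordList w).length → y.toCon w (w * s) := fun w hw => by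
    change List.take _ _ = List.take _ _
    rw [wordList_mul, List.take_append_of_le_length hw]
  have h1 : (ν.sup z).toCon u (u * s) := by
    have hvs : z.toCon v (v * s) :=
      Or.inr ⟨Word.Below.refl v, (Word.Below.refl v).mul_right s, hy v hlen⟩
    exact trans _ (sup_left huv) (trans _ (sup_right hvs)
      (sup_left ((hn.mul_left v).related (hn.mul_left u))))
  have hper : z.toCon (SemigroupVarieties.spow (FreeSemigroup.of 0) (wordList v).length)
      (SemigroupVarieties.spow (FreeSemigroup.of 0) ((wordList v).length + 1)) := by
    refine Or.inr ⟨below_spow v le_rfl, below_spow v (Nat.le_succ _), ?_⟩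
    change List.take _ _ = List.take _ _
    rw [wordList_spow, wordList_spow, List.take_replicate, List.take_replicate]
    congr 1
    omega
  have hzy : ∀ p q, z.toCon p q → y.toCon p q := by
    rintro p q (rfl | ⟨_, _, h⟩)
    · exact y.refl p
    · exact h
  have h2 := hmod y z hzy ⟨_, hper⟩ u (u * s) h1 (hy u le_rfl)
  -- Both `ν ∧ y` and `z` relate `u` to itself only.
  have hstep : ∀ w, (ν.inf y).toCon u w → w = u := by
    rintro w ⟨hνw, hyw⟩
    change List.take _ _ = List.take _ _ at hyw
    rw [List.take_length] at hyw
    obtain ⟨t, ht⟩ : ∃ t, wordList w = wordList u ++ t :=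
      ⟨(wordList w).drop (wordList u).length, by
        conv_rhs => enter [1]; rw [hyw]
        exact (List.take_append_drop _ _).symm⟩
    rcases eq_or_ne t [] with rfl | hne
    · exact wordList_injective (by simpa using ht)
    · obtain ⟨t, rfl⟩ := exists_wordList_eq hne
      rw [wordList_injective (ht.trans (wordList_mul u t).symm)] at hνw
      exact absurd (isZeroWord_of_related_mul hn hνw) hu
  have h3 : Setoid.ker (fun w => w = u) u (u * s) := by
    refine sup_rec _ (fun p q h => ?_) (fun p q h => ?_) h2
    · refine propext ⟨?_, ?_⟩
      · rintro rfl
        exact hstep q h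
      · rintro rfl
        exact hstep p ((ν.inf y).symm h)
    · rcases h with rfl | ⟨hp, hq, _⟩
      · rfl
      · refine propext ⟨?_, ?_⟩
        · rintro rfl
          exact absurd hp hvu
        · rintro rfl
          exact absurd hq hvu
  have h4 : u * s = u := (iff_of_eq h3).1 rfl
  have h5 := congrArg (fun w => (wordList w).length) h4
  have := List.length_pos_iff.2 (wordList_ne_nil s)
  simp only [wordList_mul, List.length_append] at h5
  omega

theorem isSubstitutive_of_related {ν : FullyInvariantCon} {n : ℕ}
    (hn : ν.IsZeroWord (spow (FreeSemigroup.of 0) n)) (hmod : ν.PeriodicModular) {u v : Word}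
    (huv : ν.toCon u v) (hu : ¬ ν.IsZeroWord u) : IsSubstitutive u v := by
  have halph := alph_eq_of_related hn huv hu
  have hv : ¬ ν.IsZeroWord v := fun hv => hu (hv.congr huv)
  rcases le_total (wordList u).length (wordList v).length with hlen | hlen
  · exact (isSubstitutive_of_below (below_of_related hn hmod huv hu hlen) halph.symm hlen).symm
  · exact isSubstitutive_of_below (below_of_related hn hmod (ν.symm huv) hv hlen) halph hlen

/-! ### Congruences of check sets -/

/-- The equivalence relation on lists of letters that is `s` on the words of `M` and makes all other
lists equivalent. -/
def extendSetoid (M : CheckSet) (s : Setoid M.words) : Setoid (List ℕ) where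
  r k l := ((∀ m ∈ M.words, wordList m ≠ k) ∧ ∀ m ∈ M.words, wordList m ≠ l) ∨
    ∃ m m' : M.words, k = wordList m ∧ l = wordList m' ∧ s m m'
  iseqv := by
    refine ⟨fun k => ?_, ?_, ?_⟩
    · by_cases h : ∀ m ∈ M.words, wordList m ≠ k
      · exact Or.inl ⟨h, h⟩
      · push Not at h
        obtain ⟨m, hm, rfl⟩ := h
        exact Or.inr ⟨⟨m, hm⟩, ⟨m, hm⟩, rfl, rfl, Setoid.refl' s _⟩
    · rintro k l (⟨h, h'⟩ | ⟨m, m', h, h', hs⟩)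
      · exact Or.inl ⟨h', h⟩
      · exact Or.inr ⟨m', m, h', h, Setoid.symm' s hs⟩
    · rintro k l j (⟨h, h'⟩ | ⟨m, m', rfl, rfl, hs⟩) (⟨g, g'⟩ | ⟨o, o', e, rfl, ht⟩)
      · exact Or.inl ⟨h, g'⟩
      · exact absurd e.symm (h' o o.2)
      · exact absurd rfl (g m' m'.2)
      · obtain rfl : m' = o := Subtype.ext (wordList_injective e)
        exact Or.inr ⟨m, o', rfl, rfl, Setoid.trans' s hs ht⟩

theorem extendSetoid_iff {M : CheckSet} {s : Setoid M.words} (m m' : M.words) :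
    extendSetoid M s (wordList m) (wordList m') ↔ s m m' := by
  constructor
  · rintro (⟨h, -⟩ | ⟨o, o', h, h', hs⟩)
    · exact absurd rfl (h m m.2)
    · obtain rfl : m = o := Subtype.ext (wordList_injective h)
      obtain rfl : m' = o' := Subtype.ext (wordList_injective h')
      exact hs
  · exact fun h => Or.inr ⟨m, m', rfl, rfl, h⟩

theorem extendSetoid_mono {M : CheckSet} {s t : Setoid M.words} (hst : s ≤ t) {k l : List ℕ}
    (h : extendSetoid M s k l) : extendSetoid M t k l := by
  rcases h with h | ⟨m, m', h, h', hs⟩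
  · exact Or.inl h
  · exact Or.inr ⟨m, m', h, h', hst hs⟩

/-- The largest fully invariant congruence on `F` contained in `extendSetoid M s`. -/
def syntacticCon (M : CheckSet) (s : Setoid M.words) : FullyInvariantCon where
  r u v := ∀ (ξ : Word →ₙ* Word) (a b : List ℕ),
    extendSetoid M s (a ++ wordList (ξ u) ++ b) (a ++ wordList (ξ v) ++ b)
  iseqv := ⟨fun _ _ _ _ => Setoid.refl' _ _, fun h ξ a b => Setoid.symm' _ (h ξ a b),
    fun h k ξ a b => Setoid.trans' _ (h ξ a b) (k ξ a b)⟩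
  mul' {w x y z} h k ξ a b := by
    have h1 := h ξ a (wordList (ξ y) ++ b)
    have h2 := k ξ (a ++ wordList (ξ x)) b
    simp only [map_mul, wordList_mul, List.append_assoc] at h1 h2 ⊢
    exact Setoid.trans' _ h1 h2
  map_endo ξ u v h η a b := h (η.comp ξ) a b

theorem extendSetoid_of_syntacticCon {M : CheckSet} {s : Setoid M.words} {u v : Word}
    (h : (syntacticCon M s).toCon u v) : extendSetoid M s (wordList u) (wordList v) := by
  simpa using h (MulHom.id Word) [] []

/-- If a context turns a word of a check set into a word of the check set, then the context is
trivial and the substitution permutes the letters of the check set. -/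
theorem exists_perm_of_mem_checkSet {M : CheckSet} {ξ : Word →ₙ* Word} {a b : List ℕ} {m w : Word}
    (hm : m ∈ M.words) (hw : w ∈ M.words) (h : wordList w = a ++ wordList (ξ m) ++ b) :
    a = [] ∧ b = [] ∧ ∃ σ : Equiv.Perm M.letters, ∀ m' ∈ M.words, ξ m' = permRename σ m' := by
  have hmw : m.Below w := below_iff.2 ⟨ξ, a, b, h⟩
  have hwm : w.Below m := by
    by_contra hwm
    exact M.not_strictlyBelow m hm w hw ⟨hmw, fun he => hwm he.2⟩
  have hle := hwm.length_le
  have hle' := length_le_length_endo ξ m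
  have hl := congrArg List.length h
  simp only [List.length_append] at hl
  obtain rfl : a = [] := List.length_eq_zero_iff.1 (by omega)
  obtain rfl : b = [] := List.length_eq_zero_iff.1 (by omega)
  obtain rfl : w = ξ m := wordList_injective (by simpa using h)
  have hA := M.alph_eq m hm
  obtain ⟨σ, hσ⟩ := exists_perm_of_length_le ξ m hle ((M.alph_eq _ hw).trans hA.symm)
  generalize hB : m.alph = B at σ hσ hA
  subst hA
  refine ⟨rfl, rfl, σ, fun m' hm' => endo_eq_rename ξ _ m' fun n hn => ?_⟩
  rw [M.alph_eq m' hm'] at hn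
  rw [Equiv.Perm.ofSubtype_apply_of_mem σ hn]
  exact hσ n hn

theorem syntacticCon_of_related {M : CheckSet} (β : M.ConLattice) {m m' : M.words}
    (h : β.toSetoid m m') : (syntacticCon M β.toSetoid).toCon m m' := by
  intro ξ a b
  have key : ∀ m m' : M.words, β.toSetoid m m' → ∀ w ∈ M.words,
      wordList w = a ++ wordList (ξ m) ++ b →
      extendSetoid M β.toSetoid (a ++ wordList (ξ m) ++ b) (a ++ wordList (ξ m') ++ b) := by
    intro m m' h w hw e
    obtain ⟨rfl, rfl, σ, hσ⟩ := exists_perm_of_mem_checkSet m.2 hw e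
    refine Or.inr ⟨σ • m, σ • m', ?_, ?_, β.smul σ h⟩
    · rw [hσ m m.2, List.nil_append, List.append_nil]
      rfl
    · rw [hσ m' m'.2, List.nil_append, List.append_nil]
      rfl
  by_cases h1 : ∃ w ∈ M.words, wordList w = a ++ wordList (ξ m) ++ b
  · obtain ⟨w, hw, e⟩ := h1
    exact key m m' h w hw e
  by_cases h2 : ∃ w ∈ M.words, wordList w = a ++ wordList (ξ m') ++ b
  · obtain ⟨w, hw, e⟩ := h2
    exact Setoid.symm' _ (key m' m (Setoid.symm' _ h) w hw e)
  push Not at h1 h2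
  exact Or.inl ⟨h1, h2⟩

/-- Congruences `β ≤ γ` of the check set extend to fully invariant congruences that saturate the
check set, so that the modular law can be transported from the latter to the former. -/
theorem isModularElement_restrict {ν : FullyInvariantCon} {n : ℕ}
    (hn : ν.IsZeroWord (spow (FreeSemigroup.of 0) n)) (hmod : ν.PeriodicModular) (M : CheckSet)
    (hM : ∀ m ∈ M.words, ¬ ν.IsZeroWord m) : IsModularElement (ν.restrict M) := by
  intro β γ hβγ
  refine le_antisymm ?_ (le_inf (sup_le_sup_right inf_le_left _) (sup_le inf_le_right hβγ))
  rintro p q ⟨h1, h2⟩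
  let y := syntacticCon M γ.toSetoid
  let z := syntacticCon M β.toSetoid
  have hnot : ∀ (k : ℕ) (ξ : Word →ₙ* Word) (a b : List ℕ), n ≤ k → ∀ m ∈ M.words, wordList m ≠
      a ++ wordList (ξ (SemigroupVarieties.spow (FreeSemigroup.of 0) k)) ++ b := by
    intro k ξ a b hk m hm e
    rw [map_spow] at e
    exact hM m hm (((hn.spow_of_le hk).spow _).of_infix e)
  have hper : ∃ k, z.toCon (SemigroupVarieties.spow (FreeSemigroup.of 0) k)
      (SemigroupVarieties.spow (FreeSemigroup.of 0) (k + 1)) :=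
    ⟨n, fun ξ a b => Or.inl ⟨hnot n ξ a b le_rfl, hnot (n + 1) ξ a b (Nat.le_succ n)⟩⟩
  have hsup : (ν.sup z).toCon p q := by
    have key : (ν.restrict M).toSetoid ⊔ β.toSetoid ≤ (ν.sup z).toSetoid.comap Subtype.val :=
      sup_le (fun {_ _} h => sup_left h) (fun {_ _} h => sup_right (syntacticCon_of_related β h))
    exact key h1
  have h3 := hmod y z (fun _ _ h ξ a b => extendSetoid_mono hβγ (h ξ a b)) hper p q hsup
    (syntacticCon_of_related γ h2)
  let δ : M.ConLattice := ν.restrict M ⊓ γ ⊔ β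
  have h4 : (extendSetoid M δ.toSetoid).comap wordList p q := by
    refine sup_rec _ ?_ ?_ h3
    · rintro p q ⟨hν, hy⟩
      rcases extendSetoid_of_syntacticCon hy with h | ⟨m, m', h, h', hγ⟩
      · exact Or.inl h
      · refine Or.inr ⟨m, m', h, h', (le_sup_left : ν.restrict M ⊓ γ ≤ δ) ⟨?_, hγ⟩⟩
        rwa [wordList_injective h, wordList_injective h'] at hν
    · intro p q hz
      exact extendSetoid_mono (le_sup_right : β ≤ δ) (extendSetoid_of_syntacticCon hz)
  exact (extendSetoid_iff p q).1 h4

end FullyInvariantCon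

/-! ### Free semigroups of varieties -/

theorem lift_quotient (c : FullyInvariantCon) (f : ℕ → Word) (w : Word) :
    FreeSemigroup.lift (fun n => (⟨(f n : c.toCon.Quotient)⟩ : ULift.{u} c.toCon.Quotient)) w =
      ⟨(FreeSemigroup.lift f w : Word)⟩ := by
  induction w using FreeSemigroup.recOnMul with
  | ih1 n => simp
  | ih2 n w h1 h2 =>
    rw [map_mul, map_mul, h1, h2]
    rfl

theorem exists_lift_quotient (c : FullyInvariantCon) (φ : ℕ → ULift.{u} c.toCon.Quotient) :
    ∃ f : ℕ → Word, ∀ w, FreeSemigroup.lift φ w = ⟨(FreeSemigroup.lift f w : Word)⟩ := by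
  have h : ∀ n, ∃ w : Word, (⟨(w : c.toCon.Quotient)⟩ : ULift.{u} c.toCon.Quotient) = φ n := by
    intro n
    obtain ⟨q⟩ := φ n
    induction q using Con.induction_on with
    | _ w => exact ⟨w, rfl⟩
  choose f hf using h
  obtain rfl : _ = φ := funext hf
  exact ⟨f, lift_quotient c f⟩

/-- The quotient of `F` by a fully invariant congruence satisfies precisely the identities belonging
to the congruence. -/
theorem satisfies_quotient_iff (c : FullyInvariantCon) (p q : Word) :
    Satisfies (ULift.{u} c.toCon.Quotient) p q ↔ c.toCon p q := by
  constructor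
  · intro h
    have := h fun n => ⟨(FreeSemigroup.of n : Word)⟩
    rw [lift_quotient, lift_quotient] at this
    have hid : FreeSemigroup.lift (FreeSemigroup.of : ℕ → Word) = MulHom.id Word :=
      FreeSemigroup.hom_ext (by funext n; simp)
    rw [hid] at this
    exact (Con.eq c.toCon).1 (congrArg ULift.down this)
  · intro h φ
    obtain ⟨f, hf⟩ := exists_lift_quotient c φ
    rw [hf, hf]
    exact congrArg ULift.up ((Con.eq c.toCon).2 (c.map_endo _ _ _ h))

/-- The identities of a semigroup, as an equivalence relation on words. -/
def identities (S : Type u) [Semigroup S] : Setoid Word where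
  r := Satisfies S
  iseqv := ⟨fun _ _ => rfl, fun h φ => (h φ).symm, fun h k φ => (h φ).trans (k φ)⟩

theorem exists_not_mem_alph (w : Word) : ∃ x, x ∉ w.alph := Infinite.exists_notMem_finset _

theorem lift_congr {S : Type u} [Semigroup S] {φ ψ : ℕ → S} {w : Word}
    (h : ∀ n ∈ w.alph, φ n = ψ n) : FreeSemigroup.lift φ w = FreeSemigroup.lift ψ w := by
  induction w using FreeSemigroup.recOnMul with
  | ih1 n => simpa using h n (by simp [Word.alph])
  | ih2 n w h1 h2 =>
    rw [alph_of_mul] at h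
    rw [map_mul, map_mul, h2 fun i hi => h i (Finset.mem_insert_of_mem hi)]
    simp [h n (Finset.mem_insert_self _ _)]

/-- A word which the identities of `S` make a zero takes the zero of `S` as its only value: the
factor `s` is substituted for a letter not occurring in the word. -/
theorem isZeroElement_lift {c : FullyInvariantCon} {S : Type u} [Semigroup S]
    (hS : ∀ p q, c.toCon p q → Satisfies S p q) {w : Word} (hw : c.IsZeroWord w) (φ : ℕ → S) :
    IsZeroElement (FreeSemigroup.lift φ w) := by
  intro s
  obtain ⟨x, hx⟩ := exists_not_mem_alph w
  have h := hw (FreeSemigroup.of x)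
  have h1 := hS _ _ h.1 (Function.update φ x s)
  have h2 := hS _ _ h.2 (Function.update φ x s)
  have e : FreeSemigroup.lift (Function.update φ x s) w = FreeSemigroup.lift φ w :=
    lift_congr fun n hn => Function.update_of_ne (fun e : n = x => hx (e ▸ hn)) _ _
  simp only [map_mul, e, FreeSemigroup.lift_of, Function.update_self] at h1 h2
  exact ⟨h1, h2⟩

namespace SemigroupVariety

theorem mem_iff (V : SemigroupVariety.{u}) (S : Type u) [Semigroup S] :
    V.Mem S ↔ ∀ p q, V.sim.toCon p q → Satisfies S p q := by
  refine ⟨fun h p q hpq => hpq S h, fun h => ?_⟩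
  obtain ⟨E, hE⟩ := V.exists_identities
  exact (hE S).2 fun p hp => h p.1 p.2 fun T _ hT => (hE T).1 hT p hp

/-- The variety defined by the identities of a fully invariant congruence. -/
def ofCon (c : FullyInvariantCon) : SemigroupVariety.{u} where
  Mem S _ := ∀ p q, c.toCon p q → Satisfies S p q
  exists_identities := ⟨{p | c.toCon p.1 p.2}, fun _ _ =>
    ⟨fun h p hp => h p.1 p.2 hp, fun h p q hpq => h (p, q) hpq⟩⟩

theorem holds_ofCon_iff (c : FullyInvariantCon) (p q : Word) :
    (ofCon.{u} c).Holds p q ↔ c.toCon p q :=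
  ⟨fun h => (satisfies_quotient_iff.{u} c p q).1
    (h _ fun _ _ => (satisfies_quotient_iff c _ _).2), fun h _ _ hS => hS p q h⟩

theorem holdsZero_of_isZeroWord {V : SemigroupVariety.{u}} {w : Word}
    (hw : V.sim.IsZeroWord w) : V.HoldsZero w :=
  fun S _ hS φ => isZeroElement_lift ((V.mem_iff S).1 hS) hw φ

theorem exists_isZeroWord_spow {V : SemigroupVariety.{u}} (hV : V.IsNil) :
    ∃ n, V.sim.IsZeroWord (spow (FreeSemigroup.of 0) n) := by
  have hmem : V.Mem (ULift.{u} V.sim.toCon.Quotient) :=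
    (V.mem_iff _).2 fun p q => (satisfies_quotient_iff V.sim p q).2
  obtain ⟨z, hz, hpow⟩ := hV _ hmem ⟨⟨(FreeSemigroup.of 0 : Word)⟩⟩
  obtain ⟨n, hn⟩ := hpow ⟨(FreeSemigroup.of 0 : Word)⟩
  have he : (⟨(spow (FreeSemigroup.of 0) n : Word)⟩ : ULift.{u} V.sim.toCon.Quotient) = z := by
    rw [← hn]
    let f : Word →ₙ* ULift.{u} V.sim.toCon.Quotient := ⟨fun w => ⟨(w : Word)⟩, fun _ _ => rfl⟩
    exact map_spow f (FreeSemigroup.of 0) n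
  refine ⟨n, fun p => ?_⟩
  have h := hz ⟨(p : Word)⟩
  rw [← he] at h
  exact ⟨(Con.eq _).1 (congrArg ULift.down h.1), (Con.eq _).1 (congrArg ULift.down h.2)⟩

theorem periodicModular {V : SemigroupVariety.{u}} (hV : IsModularElement V) :
    V.sim.PeriodicModular := by
  intro y z hzy _ p q hpq hy
  have hYZ : ofCon.{u} y ≤ ofCon z := fun S _ hS p q h => hS p q (hzy p q h)
  have h := hV _ _ hYZ
  let c := (V.sim.inf y).sup z
  have hc : ((V ⊔ ofCon y) ⊓ ofCon z).Mem (ULift.{u} c.toCon.Quotient) := by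
    refine ⟨fun a b h1 h2 => ?_, fun a b hab => ?_⟩
    · exact (satisfies_quotient_iff c a b).2
        (FullyInvariantCon.sup_left ⟨h1, (holds_ofCon_iff.{u} y a b).1 h2⟩)
    · exact (satisfies_quotient_iff c a b).2 (FullyInvariantCon.sup_right hab)
  rw [h] at hc
  refine (satisfies_quotient_iff.{u} c p q).1 (hc p q ?_ ((holds_ofCon_iff y p q).2 hy))
  intro S _ hS
  exact FullyInvariantCon.sup_rec (identities S) ((V.mem_iff S).1 hS.1) hS.2 hpq

end SemigroupVariety

/-! ### Epigroup varieties in which pseudoinversion is a power -/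

/-- The semigroup word obtained from a term by replacing each subterm `bar s` by the power
`s ^ (n + 1)`. -/
def UnaryTerm.toWord (n : ℕ) : UnaryTerm → Word
  | letter i => FreeSemigroup.of i
  | mul s t => toWord n s * toWord n t
  | bar s => spow (toWord n s) n

/-- The semigroup word obtained from a unary word by replacing pseudoinversion by the power
`x ^ (n + 1)`. -/
def UnaryWord.toWord (n : ℕ) : UnaryWord → Word :=
  Quotient.lift (UnaryTerm.toWord n) fun _ _ h => by
    induction h with
    | refl s => rfl
    | symm _ ih => exact ih.symm
    | trans _ _ ih ih' => exact ih.trans ih'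
    | assoc s t r => exact mul_assoc _ _ _
    | mul _ _ ih ih' => exact congrArg₂ (· * ·) ih ih'
    | bar _ ih => exact congrArg (spow · n) ih

theorem UnaryWord.eval_eq_lift_toWord {S : Type u} [UnarySemigroup S] {n : ℕ}
    (hS : ∀ x : S, UnarySemigroup.bar x = spow x n) (φ : ℕ → S) (w : UnaryWord) :
    UnaryWord.eval φ w = FreeSemigroup.lift φ (w.toWord n) := by
  obtain ⟨t⟩ := w
  change UnaryTerm.eval φ t = FreeSemigroup.lift φ (t.toWord n)
  induction t with
  | letter i => simp [UnaryTerm.eval, UnaryTerm.toWord]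
  | mul s t ih ih' => rw [UnaryTerm.eval, UnaryTerm.toWord, map_mul, ih, ih']
  | bar s ih => rw [UnaryTerm.eval, UnaryTerm.toWord, map_spow, hS, ih]

theorem UnaryWord.satisfies_ofWord_iff {S : Type u} [UnarySemigroup S] (p q : Word) :
    UnaryWord.Satisfies S (UnaryWord.ofWord p) (UnaryWord.ofWord q) ↔
      SemigroupVarieties.Satisfies S p q := by
  simp only [UnaryWord.Satisfies, SemigroupVarieties.Satisfies, UnaryWord.eval_ofWord]

theorem UnaryWord.satisfies_iff_toWord {S : Type u} [UnarySemigroup S] {n : ℕ}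
    (hS : ∀ x : S, UnarySemigroup.bar x = spow x n) (u v : UnaryWord) :
    UnaryWord.Satisfies S u v ↔ SemigroupVarieties.Satisfies S (u.toWord n) (v.toWord n) := by
  simp only [UnaryWord.Satisfies, SemigroupVarieties.Satisfies, eval_eq_lift_toWord hS]

theorem isEpigroup_of_spow {S : Type u} [UnarySemigroup S] {n : ℕ}
    (hbar : ∀ x : S, UnarySemigroup.bar x = spow x n)
    (hper : ∀ x : S, spow x n = spow x (n + 1)) : IsEpigroup S := by
  intro x
  have h1 : spow x n * x = spow x n := (hper x).symm
  have h2 : ∀ k, spow x n * spow x k = spow x n := by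
    intro k
    induction k with
    | zero => exact h1
    | succ k ih => rw [spow, ← mul_assoc, ih, h1]
  refine EpigroupVariety.EpiEq.isPseudoinverse (n := n) ⟨?_, ?_, ?_⟩
  · rw [hbar]
    exact (EpigroupVariety.spow_comm x x rfl n).symm
  · rw [hbar, h1, h2]
  · rw [hbar, ← hper, h2]

/-- The semigroup `S` with the power `x ^ (n + 1)` as its unary operation. -/
abbrev powerUnarySemigroup (S : Type u) [Semigroup S] (n : ℕ) : UnarySemigroup S where
  bar x := spow x n

theorem spow_stable {c : FullyInvariantCon} {k n : ℕ}
    (hc : c.toCon (spow (FreeSemigroup.of 0) k) (spow (FreeSemigroup.of 0) (k + 1))) (hkn : k ≤ n) :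
    c.toCon (spow (FreeSemigroup.of 0) n) (spow (FreeSemigroup.of 0) (n + 1)) := by
  induction hkn with
  | refl => exact hc
  | step _ ih => exact c.toCon.mul ih (c.refl _)

namespace EpigroupVariety

theorem mem_iff (V : EpigroupVariety.{u}) (S : Type u) [UnarySemigroup S] :
    V.Mem S ↔ ∀ p q, V.Holds p q → UnaryWord.Satisfies S p q := by
  refine ⟨fun h p q hpq => hpq S h, fun h => ?_⟩
  obtain ⟨E, hE⟩ := V.exists_identities
  exact (hE S).2 fun p hp => h p.1 p.2 fun T _ hT => (hE T).1 hT p hp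

/-- The variety of epigroups defined by the identities of a fully invariant congruence that contains
`x ^ (n + 1) ≈ x ^ (n + 2)`, and by `bar x ≈ x ^ (n + 1)`. -/
def ofCon (c : FullyInvariantCon) (n : ℕ)
    (hc : c.toCon (spow (FreeSemigroup.of 0) n) (spow (FreeSemigroup.of 0) (n + 1))) :
    EpigroupVariety.{u} where
  Mem S _ := (∀ p q, c.toCon p q → Satisfies S p q) ∧ ∀ x : S, UnarySemigroup.bar x = spow x n
  exists_identities := by
    let b := UnaryWord.letter 0
    refine ⟨{p | ∃ a b, c.toCon a b ∧ p = (UnaryWord.ofWord a, UnaryWord.ofWord b)} ∪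
      {(UnarySemigroup.bar b, spow b n)}, fun S _ => ⟨?_, ?_⟩⟩
    · rintro ⟨h, hbar⟩ p (⟨a, b, hab, rfl⟩ | rfl)
      · exact (UnaryWord.satisfies_ofWord_iff a b).2 (h a b hab)
      · intro φ
        rw [eval_spow, UnaryWord.eval_bar, hbar]
    · intro h
      refine ⟨fun p q hpq => ?_, fun x => ?_⟩
      · exact (UnaryWord.satisfies_ofWord_iff p q).1 (h _ (Or.inl ⟨p, q, hpq, rfl⟩))
      · have := h _ (Or.inr rfl) fun _ => x
        simpa only [eval_spow, UnaryWord.eval_bar, b, UnaryWord.eval_letter] using this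
  isEpigroup S _ h := isEpigroup_of_spow h.2 fun x => by
    have := h.1 _ _ hc fun _ => x
    rwa [map_spow, map_spow, FreeSemigroup.lift_of] at this

/-- In a nilsemigroup the idempotent `x * bar x` is zero, hence so are `bar x` and the powers of `x`
with a large exponent. -/
theorem EpiEq.isZeroElement_bar_and_eq_spow {S : Type u} [UnarySemigroup S]
    (hS : IsNilSemigroup S) {n : ℕ} {x : S} (h : EpiEq n x) : IsZeroElement (UnarySemigroup.bar x) ∧
      UnarySemigroup.bar x = spow x n := by
  obtain ⟨z, hz, hpow⟩ := hS
  obtain ⟨h1, h2, h3⟩ := h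
  have hidem : (x * UnarySemigroup.bar x) * (x * UnarySemigroup.bar x) =
      x * UnarySemigroup.bar x := by
    rw [mul_assoc, ← mul_assoc (UnarySemigroup.bar x), h2]
  have hk : ∀ k, spow (x * UnarySemigroup.bar x) k = x * UnarySemigroup.bar x := by
    intro k
    induction k with
    | zero => rfl
    | succ k ih => rw [spow, ih, hidem]
  obtain ⟨k, hk'⟩ := hpow (x * UnarySemigroup.bar x)
  rw [hk] at hk'
  have hbar : UnarySemigroup.bar x = z := by
    rw [← h2, ← h1, hk', (hz _).1]
  refine ⟨hbar ▸ hz, ?_⟩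
  rw [← h3, hbar, (hz _).2]

theorem exists_bar_eq_spow {V : EpigroupVariety.{u}} (hV : V.IsNil) :
    ∃ n, ∀ m, n ≤ m → ∀ (S : Type u) [UnarySemigroup S], V.Mem S → ∀ x : S,
      IsZeroElement (UnarySemigroup.bar x) ∧ UnarySemigroup.bar x = spow x m := by
  obtain ⟨n, hn⟩ := V.exists_uniform
  exact ⟨n, fun m hm S _ hS x =>
    ((hn S hS x).mono hm).isZeroElement_bar_and_eq_spow (hV S hS ⟨x⟩)⟩

theorem holdsZero_of_isZeroWord {V : EpigroupVariety.{u}} {w : Word}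
    (hw : V.sim.IsZeroWord w) : V.HoldsZero (UnaryWord.ofWord w) := by
  intro S _ hS φ
  rw [UnaryWord.eval_ofWord]
  refine isZeroElement_lift (c := V.sim) (fun p q h => ?_) hw φ
  exact (UnaryWord.satisfies_ofWord_iff p q).1 (h S hS)

theorem exists_isZeroWord_spow {V : EpigroupVariety.{u}} (hV : V.IsNil) :
    ∃ n, V.sim.IsZeroWord (spow (FreeSemigroup.of 0) n) := by
  obtain ⟨n, hn⟩ := exists_bar_eq_spow hV
  have hz : ∀ (S : Type u) [UnarySemigroup S], V.Mem S → ∀ φ : ℕ → S,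
      IsZeroElement (FreeSemigroup.lift φ (spow (FreeSemigroup.of 0) n)) := fun S _ hS φ => by
    obtain ⟨h1, h2⟩ := hn n le_rfl S hS (φ 0)
    rw [map_spow, FreeSemigroup.lift_of, ← h2]
    exact h1
  refine ⟨n, fun p => ⟨fun S _ hS => ?_, fun S _ hS => ?_⟩⟩
  · refine (UnaryWord.satisfies_ofWord_iff _ _).2 fun φ => ?_
    rw [map_mul, (hz S hS φ _).1]
  · refine (UnaryWord.satisfies_ofWord_iff _ _).2 fun φ => ?_
    rw [map_mul, (hz S hS φ _).2]

/-- In a nil-variety of epigroups pseudoinverses are zero, so a word that is not zero does not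
involve pseudoinversion. -/
theorem exists_eq_ofWord {V : EpigroupVariety.{u}} (hV : V.IsNil) {w : UnaryWord}
    (hw : ¬ V.HoldsZero w) : ∃ p : Word, w = UnaryWord.ofWord p := by
  obtain ⟨n, hn⟩ := exists_bar_eq_spow hV
  obtain ⟨t⟩ := w
  induction t with
  | letter i => exact ⟨FreeSemigroup.of i, by simp [UnaryWord.ofWord]; rfl⟩
  | mul s t ih ih' =>
    obtain ⟨p, hp⟩ := ih fun h => hw fun S _ hS φ => by
      have hz : IsZeroElement (UnaryTerm.eval φ s) := h S hS φ
      change IsZeroElement (UnaryTerm.eval φ s * UnaryTerm.eval φ t)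
      rwa [(hz _).1]
    obtain ⟨q, hq⟩ := ih' fun h => hw fun S _ hS φ => by
      have hz : IsZeroElement (UnaryTerm.eval φ t) := h S hS φ
      change IsZeroElement (UnaryTerm.eval φ s * UnaryTerm.eval φ t)
      rwa [(hz _).2]
    refine ⟨p * q, ?_⟩
    rw [map_mul, ← hp, ← hq]
    rfl
  | bar s _ =>
    refine absurd ?_ hw
    intro S _ hS φ
    exact (hn n le_rfl S hS (UnaryTerm.eval φ s)).1

theorem alph_ofWord (p : Word) : (UnaryWord.ofWord p).alph = p.alph := by
  induction p using FreeSemigroup.recOnMul with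
  | ih1 n => simp [UnaryWord.ofWord, Word.alph]; rfl
  | ih2 n w h1 h2 =>
    rw [alph_of_mul, ← h2, map_mul, Finset.insert_eq]
    have : ∀ a b : UnaryWord, (a * b).alph = a.alph ∪ b.alph := by
      rintro ⟨a⟩ ⟨b⟩
      rfl
    rw [this, h1]
    simp [Word.alph]

theorem ofWord_rename (f : ℕ → ℕ) (p : Word) :
    UnaryWord.ofWord (p.rename f) = (UnaryWord.ofWord p).rename f := by
  rw [UnaryWord.rename, UnaryWord.eval_ofWord]
  have h : UnaryWord.ofWord.comp (FreeSemigroup.map f) =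
      FreeSemigroup.lift fun n => UnaryWord.letter (f n) :=
    FreeSemigroup.hom_ext (by funext n; simp [UnaryWord.ofWord])
  exact DFunLike.congr_fun h p

theorem periodicModular {V : EpigroupVariety.{u}} (hnil : V.IsNil) (hV : IsModularElement V) :
    V.sim.PeriodicModular := by
  rintro y z hzy ⟨k, hk⟩ p q hpq hy
  obtain ⟨n, hn⟩ := exists_bar_eq_spow hnil
  -- One exponent for which `bar x ≈ x ^ (N + 1)` holds in `V` and defines varieties for `y`, `z`.
  let N := max k n
  have hz' := spow_stable hk (le_max_left k n)
  have hN := hn N (le_max_right k n)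
  let Y : EpigroupVariety.{u} := ofCon y N (hzy _ _ hz')
  let Z : EpigroupVariety.{u} := ofCon z N hz'
  have hYZ : Y ≤ Z := fun S _ hS => ⟨fun p q h => hS.1 p q (hzy p q h), hS.2⟩
  have hquot : ∀ d : FullyInvariantCon, ∀ u v : UnaryWord,
      letI := powerUnarySemigroup (ULift.{u} d.toCon.Quotient) N
      UnaryWord.Satisfies (ULift.{u} d.toCon.Quotient) u v ↔
        d.toCon (u.toWord N) (v.toWord N) := fun d u v => by
    let := powerUnarySemigroup (ULift.{u} d.toCon.Quotient) N
    rw [UnaryWord.satisfies_iff_toWord (fun _ => rfl)]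
    exact satisfies_quotient_iff d _ _
  let c := (V.sim.inf y).sup z
  let := powerUnarySemigroup (ULift.{u} c.toCon.Quotient) N
  have hc : ((V ⊔ Y) ⊓ Z).Mem (ULift.{u} c.toCon.Quotient) := by
    refine ⟨fun u v h1 h2 => (hquot c u v).2 (FullyInvariantCon.sup_left ⟨?_, ?_⟩),
      fun a b hab => (satisfies_quotient_iff c a b).2 (FullyInvariantCon.sup_right hab),
      fun _ => rfl⟩
    · intro S _ hS
      refine (UnaryWord.satisfies_ofWord_iff _ _).2 ?_
      exact (UnaryWord.satisfies_iff_toWord (fun x => (hN S hS x).2) u v).1 (h1 S hS)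
    · let := powerUnarySemigroup (ULift.{u} y.toCon.Quotient) N
      exact (hquot y u v).1
        (h2 _ ⟨fun a b hab => (satisfies_quotient_iff y a b).2 hab, fun _ => rfl⟩)
  rw [hV Y Z hYZ] at hc
  have h := hc (UnaryWord.ofWord p) (UnaryWord.ofWord q) ?_ fun S _ hS =>
    (UnaryWord.satisfies_ofWord_iff p q).2 (hS.1 p q hy)
  · exact (satisfies_quotient_iff.{u} c p q).1 ((UnaryWord.satisfies_ofWord_iff p q).1 h)
  · intro S _ hS
    refine (UnaryWord.satisfies_ofWord_iff p q).2 (FullyInvariantCon.sup_rec (identities S)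
      (fun a b hab => ?_) hS.2.1 hpq)
    exact (UnaryWord.satisfies_ofWord_iff a b).1 (hab S hS.1)

end EpigroupVariety

end SemigroupVarieties

/-! ### Necessary conditions for modularity -/

/-- Necessary conditions for a nil-variety to be a modular element of the lattice of all semigroup
varieties, respectively of the lattice of all epigroup varieties. -/
theorem proposition3p1 :
    (∀ V : SemigroupVariety.{u}, V.IsNil → IsModularElement V →
      (∀ u v : Word, V.Holds u v → ¬ V.HoldsZero u → IsSubstitutive u v) ∧
      (∀ M : CheckSet, M.words ∩ V.zeroWords = ∅ → IsModularElement (V.sim.restrict M))) ∧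
    (∀ V : EpigroupVariety.{u}, V.IsNil → IsModularElement V →
      (∀ u v : UnaryWord, V.Holds u v → ¬ V.HoldsZero u → UnaryWord.IsSubstitutive u v) ∧
      (∀ M : CheckSet, M.words ∩ V.zeroWords = ∅ → IsModularElement (V.sim.restrict M))) := by
  constructor
  · intro V hnil hV
    obtain ⟨n, hn⟩ := SemigroupVariety.exists_isZeroWord_spow hnil
    have hmod := SemigroupVariety.periodicModular hV
    refine ⟨fun u v huv hu => ?_, fun M hM => ?_⟩
    · exact FullyInvariantCon.isSubstitutive_of_related hn hmod huv fun h =>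
        hu (SemigroupVariety.holdsZero_of_isZeroWord h)
    · refine FullyInvariantCon.isModularElement_restrict hn hmod M fun m hm h => ?_
      exact Set.eq_empty_iff_forall_notMem.1 hM m
        ⟨hm, SemigroupVariety.holdsZero_of_isZeroWord h⟩
  · intro V hnil hV
    obtain ⟨n, hn⟩ := EpigroupVariety.exists_isZeroWord_spow hnil
    have hmod := EpigroupVariety.periodicModular hnil hV
    refine ⟨fun u v huv hu => ?_, fun M hM => ?_⟩
    · obtain ⟨p, rfl⟩ := EpigroupVariety.exists_eq_ofWord hnil hu
      obtain ⟨q, rfl⟩ := EpigroupVariety.exists_eq_ofWord hnil (w := v) fun hv =>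
        hu fun S _ hS φ => huv S hS φ ▸ hv S hS φ
      obtain ⟨halph, σ, rfl⟩ := FullyInvariantCon.isSubstitutive_of_related hn hmod
        (u := p) (v := q) huv fun h => hu (EpigroupVariety.holdsZero_of_isZeroWord h)
      refine ⟨?_, σ, EpigroupVariety.ofWord_rename σ p⟩
      rw [EpigroupVariety.alph_ofWord, EpigroupVariety.alph_ofWord, halph]
    · refine FullyInvariantCon.isModularElement_restrict hn hmod M fun m hm h => ?_
      exact Set.eq_empty_iff_forall_notMem.1 hM m
        ⟨hm, EpigroupVariety.holdsZero_of_isZeroWord h⟩
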